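/- Let $m,n\ge 0$ be integers and $N=m+n$; everything is over $\mathbb C$. Write $M_{m,n}$ for the affine space of $m\times n$ matrices, with coordinates $x_{ij}$, and let $r^k=\sum_{1\le i<j\le k}E_{ij}\wedge E_{ji}\in\wedge^2\mathfrak{gl}_k$ be the standard $r$-matrix. For an action of $GL_k$ on a variety let $\chi$ denote the infinitesimal action, $\chi(a)_x=\frac{d}{dt}\big|_{t=0}\exp(ta).x$ for $a\in\mathfrak{gl}_k$, extended to bivectors by $\chi(a\wedge b)=\chi(a)\wedge\chi(b)$; write $\chi^L$, $\chi^R$ for the actions $g.x=gx$ of $GL_m$ and $g.x=xg^{-1}$ of $GL_n$ on $M_{m,n}$. The standard quadratic Poisson structure on $M_{m,n}$ is $$\pi^{m,n}=\chi^R(r^n)-\chi^L(r^m).$$ Let $P_n=\left[\begin{smallmatrix}GL_n&M_{n,m}\\0&GL_m\end{smallmatrix}\right]\subset GL_N$, identify the Grassmannian $\mathrm{Gr}(n,N)$ with the homogeneous variety $GL_N/P_n$, and equip it with the bivector field $-\chi(r^N)$, where $\chi$ comes from left multiplication. Let $B^-\subset GL_N$ be the group of lower triangular matrices, and let $w^n_\circ$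 be the $n\times n$ antidiagonal permutation matrix. **Proposition 3.4.** The bivector field $\pi^{m,n}$ is a Poisson structure on $M_{m,n}$, and in coordinates $$\pi^{m,n}=-\frac12\sum_{i,k=1}^m\sum_{j,l=1}^n\bigl(\operatorname{sign}(k-i)+\operatorname{sign}(l-j)\bigr)x_{il}x_{kj}\,\frac{\partial}{\partial x_{ij}}\wedge\frac{\partial}{\partial x_{kl}}.$$ The orbit $B^-.P_n$ of the base point is Zariski open in $GL_N/P_n$, the bivector field $-\chi(r^N)$ restricts to a (unique) bivector field on it, this restriction is a Poisson structure, and $$\Psi: M_{m,n}\to B^-.P_n,\qquad x\mapsto\begin{bmatrix}I_n&0\\ x\,w^n_\circ&I_m\end{bmatrix}P_n,$$ is an isomorphism of Poisson varieties from $(M_{m,n},\pi^{m,n})$ onto $(B^-.P_n,\,-\chi(r^N)|_{B^-.P_n})$: it is an isomorphism of algebraic varieties and $\Psi_*(\pi^{m,n}_x)=-\chi(r^N)_{\Psi(x)}$ for all $x$. -/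

import Mathlib

open scoped MatrixGroups Topology

noncomputable section

/-! ## Complex varieties as spaces with functions -/

/-- A space with functions over `ℂ` (a variety in the classical language): a topological space
(the Zariski topology) together with a subsheaf of algebras of the sheaf of `ℂ`-valued functions.
The sheaf is given by the notion "`f` is regular at `x`", which depends only on the germ
of `f` at `x`, so that `f` is regular on an open set `U` iff it is regular at all points of `U`. -/
structure FnSpace where
  carrier : Type
  top : TopologicalSpace carrier
  Reg : (carrier → ℂ) → carrier → Prop
  reg_congr : ∀ {f g : carrier → ℂ} {x : carrier},
    (∀ᶠ y in @nhds carrier top x, f y = g y) → Reg f x → Reg g x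
  reg_nhds : ∀ {f : carrier → ℂ} {x : carrier}, Reg f x → ∀ᶠ y in @nhds carrier top x, Reg f y
  reg_const : ∀ (c : ℂ) (x : carrier), Reg (fun _ => c) x
  reg_add : ∀ {f g : carrier → ℂ} {x : carrier}, Reg f x → Reg g x → Reg (f + g) x
  reg_mul : ∀ {f g : carrier → ℂ} {x : carrier}, Reg f x → Reg g x → Reg (f * g) x

namespace FnSpace

/-- Zariski open subsets. -/
def Open (X : FnSpace) (U : Set X.carrier) : Prop := @IsOpen X.carrier X.top U

/-- The algebra of functions that are regular at `x` (the local ring at `x` is its quotient by the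
functions vanishing near `x`). -/
def regAlg (X : FnSpace) (x : X.carrier) : Subalgebra ℂ (X.carrier → ℂ) where
  carrier := {f | X.Reg f x}
  mul_mem' := X.reg_mul
  add_mem' := X.reg_add
  algebraMap_mem' c := X.reg_const c x

/-- The (Zariski) tangent space at `x`: the derivations at `x` of the regular functions. Such a
derivation automatically depends on germs only: if `f` vanishes near `x`, then `f = f * e`, where
`e` vanishes near `x` and is `1` elsewhere, so that `D f = f x * D e + e x * D f = 0`. -/
def Tangent (X : FnSpace) (x : X.carrier) : Submodule ℂ (Module.Dual ℂ (X.regAlg x)) where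
  carrier := {D | ∀ f g : X.regAlg x, D (f * g) = f.1 x * D g + g.1 x * D f}
  zero_mem' := by intro f g; simp
  add_mem' := by
    intro D E hD hE f g
    simp only [LinearMap.add_apply, hD f g, hE f g]; ring
  smul_mem' := by
    intro c D hD f g
    simp only [LinearMap.smul_apply, hD f g, smul_eq_mul]; ring

/-- The space of bivectors at `x`. -/
abbrev Bivector (X : FnSpace) (x : X.carrier) : Type := ⋀[ℂ]^2 (X.Tangent x)

/-- `u ∧ v`. -/
def wedge {M : Type*} [AddCommGroup M] [Module ℂ M] (u v : M) : ⋀[ℂ]^2 M :=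
  exteriorPower.ιMulti ℂ 2 ![u, v]

/-- The differential `d_x f`, a covector at `x`. -/
def dfun (X : FnSpace) (x : X.carrier) (f : X.regAlg x) : Module.Dual ℂ (X.Tangent x) where
  toFun D := D.1 f
  map_add' _ _ := rfl
  map_smul' _ _ := rfl

open Classical in
/-- The bracket `{f, g} = ⟨π, df ∧ dg⟩` at a point `x` at which `f` and `g` are regular, with
`⟨u ∧ v, df ∧ dg⟩ = df u * dg v - df v * dg u`. (The value `0` elsewhere is never used.) -/
def bracket (X : FnSpace) (π : ∀ x, X.Bivector x) (f g : X.carrier → ℂ) (x : X.carrier) : ℂ :=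
  if h : X.Reg f x ∧ X.Reg g x then
    exteriorPower.pairingDual ℂ (X.Tangent x) 2
      (wedge (X.dfun x ⟨f, h.1⟩) (X.dfun x ⟨g, h.2⟩)) (π x)
  else 0

/-- `π` is a Poisson structure on `X`: it is algebraic (brackets of regular functions on an open
set are regular), and `[π, π] = 0`, that is, the bracket satisfies the Jacobi identity. -/
structure IsPoisson (X : FnSpace) (π : ∀ x, X.Bivector x) : Prop where
  regular : ∀ (U : Set X.carrier), X.Open U → ∀ f g : X.carrier → ℂ,
    (∀ x ∈ U, X.Reg f x) → (∀ x ∈ U, X.Reg g x) → ∀ x ∈ U, X.Reg (X.bracket π f g) x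
  jacobi : ∀ (U : Set X.carrier), X.Open U → ∀ f g h : X.carrier → ℂ,
    (∀ x ∈ U, X.Reg f x) → (∀ x ∈ U, X.Reg g x) → (∀ x ∈ U, X.Reg h x) → ∀ x ∈ U,
      X.bracket π f (X.bracket π g h) x + X.bracket π g (X.bracket π h f) x
        + X.bracket π h (X.bracket π f g) x = 0

/-- Morphisms of varieties: continuous maps that pull back regular functions to regular
functions. -/
structure IsMorphism (X Y : FnSpace) (φ : X.carrier → Y.carrier) : Prop where
  continuous : ∀ U, Y.Open U → X.Open (φ ⁻¹' U)
  reg : ∀ (x : X.carrier) (f : Y.carrier → ℂ), Y.Reg f (φ x) → X.Reg (f ∘ φ) x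

/-- The differential `d_x φ : T_x X → T_{φ x} Y` of a morphism. -/
def IsMorphism.differential {X Y : FnSpace} {φ : X.carrier → Y.carrier} (h : IsMorphism X Y φ)
    (x : X.carrier) : X.Tangent x →ₗ[ℂ] Y.Tangent (φ x) where
  toFun D :=
    ⟨{ toFun := fun f => D.1 ⟨f.1 ∘ φ, h.reg x f.1 f.2⟩
       map_add' := fun f g => D.1.map_add ⟨f.1 ∘ φ, h.reg x f.1 f.2⟩ ⟨g.1 ∘ φ, h.reg x g.1 g.2⟩
       map_smul' := fun c f => D.1.map_smul c ⟨f.1 ∘ φ, h.reg x f.1 f.2⟩ },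
      fun f g => D.2 ⟨f.1 ∘ φ, h.reg x f.1 f.2⟩ ⟨g.1 ∘ φ, h.reg x g.1 g.2⟩⟩
  map_add' _ _ := rfl
  map_smul' _ _ := rfl

/-- `φ` is a Poisson map from `(X, π)` to `(Y, π')`: a morphism of varieties with
`φ_* (π_x) = π'_{φ x}` for all `x`. -/
def IsPoissonMap (X Y : FnSpace) (φ : X.carrier → Y.carrier) (π : ∀ x, X.Bivector x)
    (π' : ∀ y, Y.Bivector y) : Prop :=
  ∃ h : IsMorphism X Y φ, ∀ x, exteriorPower.map 2 (h.differential x) (π x) = π' (φ x)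

/-- Poisson isomorphisms: bijections that are Poisson maps in both directions. -/
def IsPoissonIso (X Y : FnSpace) (φ : X.carrier ≃ Y.carrier) (π : ∀ x, X.Bivector x)
    (π' : ∀ y, Y.Bivector y) : Prop :=
  IsPoissonMap X Y φ π π' ∧ IsPoissonMap Y X φ.symm π' π

/-! ### Subspaces and quotients -/

/-- The structure of a space with functions induced by a map `i : S → X` (used for
inclusions of open subsets): the induced topology, and the functions that are locally of the form
`F ∘ i` with `F` regular. -/
@[reducible] def induced (X : FnSpace) {S : Type} (i : S → X.carrier) : FnSpace where
  carrier := S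
  top := X.top.induced i
  Reg f s := ∃ F, X.Reg F (i s) ∧ ∀ᶠ y in @nhds S (X.top.induced i) s, f y = F (i y)
  reg_congr := by
    rintro f g x h ⟨F, hF, e⟩
    refine ⟨F, hF, ?_⟩
    filter_upwards [h, e] with y h1 h2
    rw [← h1, h2]
  reg_nhds := by
    rintro f x ⟨F, hF, e⟩
    let _ := X.top
    let _ : TopologicalSpace S := X.top.induced i
    have hc : Filter.Tendsto i (𝓝 x) (𝓝 (i x)) := continuous_induced_dom.continuousAt
    filter_upwards [hc.eventually (X.reg_nhds hF), eventually_eventually_nhds.2 e] with y h1 h2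
    exact ⟨F, h1, h2⟩
  reg_const c x := ⟨fun _ => c, X.reg_const c _, Filter.Eventually.of_forall fun _ => rfl⟩
  reg_add := by
    rintro f g x ⟨F, hF, e⟩ ⟨G, hG, e2⟩
    refine ⟨F + G, X.reg_add hF hG, ?_⟩
    filter_upwards [e, e2] with y h1 h2
    simp [h1, h2]
  reg_mul := by
    rintro f g x ⟨F, hF, e⟩ ⟨G, hG, e2⟩
    refine ⟨F * G, X.reg_mul hF hG, ?_⟩
    filter_upwards [e, e2] with y h1 h2
    simp [h1, h2]

/-- The quotient structure of a space with functions along a map `p : X → Q`: `U ⊆ Q` is open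
iff `p ⁻¹ U` is, and `f` is regular on `U` iff `f ∘ p` is regular on `p ⁻¹ U`. -/
@[reducible] def quotient (X : FnSpace) {Q : Type} (p : X.carrier → Q) : FnSpace where
  carrier := Q
  top := X.top.coinduced p
  Reg f q := ∃ U : Set Q, X.Open (p ⁻¹' U) ∧ q ∈ U ∧ ∀ g, p g ∈ U → X.Reg (f ∘ p) g
  reg_congr := by
    rintro f g q h ⟨U, hU, hq, hf⟩
    let _ := X.top
    let _ : TopologicalSpace Q := X.top.coinduced p
    obtain ⟨V, hV, hVo, hqV⟩ := eventually_nhds_iff.1 h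
    have hVo2 : IsOpen (p ⁻¹' V) := isOpen_coinduced.1 hVo
    refine ⟨U ∩ V, hU.inter hVo2, ⟨hq, hqV⟩, fun x hx => X.reg_congr ?_ (hf x hx.1)⟩
    filter_upwards [hVo2.mem_nhds hx.2] with y hy
    exact hV _ hy
  reg_nhds := by
    rintro f q ⟨U, hU, hq, hf⟩
    let _ := X.top
    let _ : TopologicalSpace Q := X.top.coinduced p
    have hUo : IsOpen U := isOpen_coinduced.2 hU
    filter_upwards [hUo.mem_nhds hq] with y hy
    exact ⟨U, hU, hy, hf⟩
  reg_const c q := ⟨Set.univ, @isOpen_univ _ X.top, trivial, fun g _ => X.reg_const c g⟩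
  reg_add := by
    rintro f g q ⟨U, hU, hq, hf⟩ ⟨V, hV, hqV, hg⟩
    exact ⟨U ∩ V, @IsOpen.inter _ X.top _ _ hU hV, ⟨hq, hqV⟩,
      fun x hx => X.reg_add (hf x hx.1) (hg x hx.2)⟩
  reg_mul := by
    rintro f g q ⟨U, hU, hq, hf⟩ ⟨V, hV, hqV, hg⟩
    exact ⟨U ∩ V, @IsOpen.inter _ X.top _ _ hU hV, ⟨hq, hqV⟩,
      fun x hx => X.reg_mul (hf x hx.1) (hg x hx.2)⟩

end FnSpace

open FnSpace

/-! ## The variety of matrices -/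

/-- The value at `A` of a polynomial in the entries of an `m × n` matrix. -/
def evalMat {m n : ℕ} (p : MvPolynomial (Fin m × Fin n) ℂ) (A : Matrix (Fin m) (Fin n) ℂ) : ℂ :=
  MvPolynomial.eval (fun ij => A ij.1 ij.2) p

/-- The Zariski topology on `M_{m,n}(ℂ)`, with the sets `{p ≠ 0}` as a basis. -/
@[reducible] def zariski (m n : ℕ) : TopologicalSpace (Matrix (Fin m) (Fin n) ℂ) where
  IsOpen U := ∀ A ∈ U, ∃ p : MvPolynomial (Fin m × Fin n) ℂ,
    evalMat p A ≠ 0 ∧ ∀ B, evalMat p B ≠ 0 → B ∈ U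
  isOpen_univ A _ := ⟨1, by simp [evalMat], fun _ _ => trivial⟩
  isOpen_inter U V hU hV A hA := by
    obtain ⟨p, hp, hp2⟩ := hU A hA.1
    obtain ⟨q, hq, hq2⟩ := hV A hA.2
    refine ⟨p * q, by simpa [evalMat] using And.intro hp hq, fun B hB => ?_⟩
    have hB2 : evalMat p B ≠ 0 ∧ evalMat q B ≠ 0 := by simpa [evalMat] using hB
    exact ⟨hp2 B hB2.1, hq2 B hB2.2⟩
  isOpen_sUnion S hS A hA := by
    obtain ⟨U, hU, hAU⟩ := hA
    obtain ⟨p, hp, hp2⟩ := hS U hU A hAU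
    exact ⟨p, hp, fun B hB => ⟨U, hU, hp2 B hB⟩⟩

theorem zariski_eventually {m n : ℕ} {A : Matrix (Fin m) (Fin n) ℂ}
    {P : Matrix (Fin m) (Fin n) ℂ → Prop} :
    (∀ᶠ B in @nhds _ (zariski m n) A, P B) ↔
      ∃ p : MvPolynomial (Fin m × Fin n) ℂ,
        evalMat p A ≠ 0 ∧ ∀ B, evalMat p B ≠ 0 → P B := by
  let _ := zariski m n
  rw [eventually_nhds_iff]
  constructor
  · rintro ⟨U, hU, hUo, hA⟩
    obtain ⟨p, hp, hp2⟩ := hUo A hA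
    exact ⟨p, hp, fun B hB => hU B (hp2 B hB)⟩
  · rintro ⟨p, hp, hp2⟩
    exact ⟨{B | evalMat p B ≠ 0}, hp2, fun B hB => ⟨p, hB, fun _ h => h⟩, hp⟩

/-- The variety `M_{m,n}` of complex `m × n` matrices: the regular functions at `A` are those
that are, on a neighbourhood `{q ≠ 0}` of `A`, quotients `p / q` of polynomials. -/
@[reducible] def matSpace (m n : ℕ) : FnSpace where
  carrier := Matrix (Fin m) (Fin n) ℂ
  top := zariski m n
  Reg f A := ∃ p q : MvPolynomial (Fin m × Fin n) ℂ,
    evalMat q A ≠ 0 ∧ ∀ B, evalMat q B ≠ 0 → f B = evalMat p B / evalMat q B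
  reg_congr := by
    rintro f g A h ⟨p, q, hq, e⟩
    obtain ⟨r, hr, hr2⟩ := zariski_eventually.1 h
    refine ⟨p * r, q * r, by simpa [evalMat] using And.intro hq hr, fun B hB => ?_⟩
    have hB2 : evalMat q B ≠ 0 ∧ evalMat r B ≠ 0 := by simpa [evalMat] using hB
    have h3 := hB2.1
    have h4 := hB2.2
    rw [← hr2 B h4, e B h3]
    simp only [evalMat, map_mul] at h3 h4 ⊢
    field_simp
  reg_nhds := by
    rintro f A ⟨p, q, hq, e⟩
    exact zariski_eventually.2 ⟨q, hq, fun B hB => ⟨p, q, hB, e⟩⟩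
  reg_const c A := ⟨MvPolynomial.C c, 1, by simp [evalMat], fun B _ => by simp [evalMat]⟩
  reg_add := by
    rintro f g A ⟨p, q, hq, e⟩ ⟨r, s, hs, e2⟩
    refine ⟨p * s + r * q, q * s, by simpa [evalMat] using And.intro hq hs, fun B hB => ?_⟩
    have hB2 : evalMat q B ≠ 0 ∧ evalMat s B ≠ 0 := by simpa [evalMat] using hB
    have h3 := hB2.1
    have h4 := hB2.2
    rw [Pi.add_apply, e B h3, e2 B h4]
    simp only [evalMat, map_mul, map_add] at h3 h4 ⊢
    field_simp
  reg_mul := by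
    rintro f g A ⟨p, q, hq, e⟩ ⟨r, s, hs, e2⟩
    refine ⟨p * r, q * s, by simpa [evalMat] using And.intro hq hs, fun B hB => ?_⟩
    have hB2 : evalMat q B ≠ 0 ∧ evalMat s B ≠ 0 := by simpa [evalMat] using hB
    have h3 := hB2.1
    have h4 := hB2.2
    rw [Pi.mul_apply, e B h3, e2 B h4]
    simp only [evalMat, map_mul] at h3 h4 ⊢
    field_simp

/-- Polynomials are differentiable along curves, with derivative linear in the velocity. -/
theorem evalMat_hasDerivAt {m n : ℕ} (p : MvPolynomial (Fin m × Fin n) ℂ)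
    (A : Matrix (Fin m) (Fin n) ℂ) :
    ∃ L : Matrix (Fin m) (Fin n) ℂ →ₗ[ℂ] ℂ, ∀ (c : ℂ → Matrix (Fin m) (Fin n) ℂ)
      (V : Matrix (Fin m) (Fin n) ℂ), c 0 = A →
      (∀ i j, HasDerivAt (fun t => c t i j) (V i j) 0) →
      HasDerivAt (fun t => evalMat p (c t)) (L V) 0 := by
  induction p using MvPolynomial.induction_on with
  | C a => exact ⟨0, fun c V _ _ => by simpa [evalMat] using hasDerivAt_const (0 : ℂ) a⟩
  | add p q hp hq =>
    obtain ⟨L, hL⟩ := hp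
    obtain ⟨K, hK⟩ := hq
    refine ⟨L + K, fun c V h0 h => ?_⟩
    simpa [evalMat] using (hL c V h0 h).fun_add (hK c V h0 h)
  | mul_X p ij hp =>
    obtain ⟨L, hL⟩ := hp
    refine ⟨A ij.1 ij.2 • L + evalMat p A • (Matrix.entryLinearMap ℂ ℂ ij.1 ij.2),
      fun c V h0 h => ?_⟩
    have h1 := (hL c V h0 h).fun_mul (h ij.1 ij.2)
    rw [h0] at h1
    have e1 : (fun t => evalMat (p * MvPolynomial.X ij) (c t)) =
        fun t => evalMat p (c t) * c t ij.1 ij.2 := by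
      funext t; simp [evalMat]
    have e2 : (A ij.1 ij.2 • L + evalMat p A • Matrix.entryLinearMap ℂ ℂ ij.1 ij.2) V =
        L V * A ij.1 ij.2 + evalMat p A * V ij.1 ij.2 := by
      simp; ring
    rw [e1, e2]
    exact h1

theorem matSpace_hasDerivAt {m n : ℕ} {f : Matrix (Fin m) (Fin n) ℂ → ℂ}
    {A : Matrix (Fin m) (Fin n) ℂ} (hf : (matSpace m n).Reg f A) :
    ∃ L : Matrix (Fin m) (Fin n) ℂ →ₗ[ℂ] ℂ, ∀ (c : ℂ → Matrix (Fin m) (Fin n) ℂ)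
      (V : Matrix (Fin m) (Fin n) ℂ), c 0 = A →
      (∀ i j, HasDerivAt (fun t => c t i j) (V i j) 0) →
      HasDerivAt (fun t => f (c t)) (L V) 0 := by
  obtain ⟨p, q, hq, e⟩ := hf
  obtain ⟨L, hL⟩ := evalMat_hasDerivAt p A
  obtain ⟨K, hK⟩ := evalMat_hasDerivAt q A
  refine ⟨(evalMat q A ^ 2)⁻¹ • (evalMat q A • L - evalMat p A • K), fun c V h0 h => ?_⟩
  have h1 := hL c V h0 h
  have h2 := hK c V h0 h
  have h3 := h1.div h2 (by rw [h0]; exact hq)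
  have h4 : ∀ᶠ t in 𝓝 (0 : ℂ), evalMat q (c t) ≠ 0 :=
    h2.continuousAt.eventually_ne (by rw [h0]; exact hq)
  have h5 := h3.congr_of_eventuallyEq (f₁ := fun t => f (c t)) (by
    filter_upwards [h4] with t ht
    exact e _ ht)
  rw [h0] at h5
  have e3 : ((evalMat q A ^ 2)⁻¹ • (evalMat q A • L - evalMat p A • K)) V =
      (L V * evalMat q A - evalMat p A * K V) / evalMat q A ^ 2 := by
    simp only [LinearMap.smul_apply, LinearMap.sub_apply, smul_eq_mul]
    field_simp
  rw [e3]
  exact h5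

theorem zariski_tendsto {m n : ℕ} {c : ℂ → Matrix (Fin m) (Fin n) ℂ}
    {V : Matrix (Fin m) (Fin n) ℂ}
    (h : ∀ i j, HasDerivAt (fun t => c t i j) (V i j) 0) :
    Filter.Tendsto c (𝓝 0) (@nhds _ (zariski m n) (c 0)) := by
  intro S hS
  obtain ⟨p, hp, hp2⟩ := (zariski_eventually (P := fun B => B ∈ S)).1 hS
  obtain ⟨L, hL⟩ := evalMat_hasDerivAt p (c 0)
  have := (hL c V rfl h).continuousAt.eventually_ne hp
  exact this.mono fun t ht => hp2 _ ht

/-! ## Groups and infinitesimal actions -/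

/-- The element `exp a` of `GL_k`. -/
def expGL {k : ℕ} (a : Matrix (Fin k) (Fin k) ℂ) : GL (Fin k) ℂ where
  val := NormedSpace.exp a
  inv := NormedSpace.exp (-a)
  val_inv := by
    rw [← Matrix.exp_add_of_commute _ _ (Commute.neg_right (Commute.refl a)), add_neg_cancel,
      NormedSpace.exp_zero]
  inv_val := by
    rw [← Matrix.exp_add_of_commute _ _ (Commute.neg_left (Commute.refl a)), neg_add_cancel,
      NormedSpace.exp_zero]

/-- A map `act : GL_k × X → X` for which `1` acts as the identity, and for which the one-parameter
subgroups have velocities: the regular functions are differentiable along the curves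
`t ↦ exp (t a) . x` at `t = 0`, and the derivative is linear in `a`. -/
structure HasInfAction (k : ℕ) (X : FnSpace) (act : GL (Fin k) ℂ → X.carrier → X.carrier) :
    Prop where
  one : ∀ x, act 1 x = x
  deriv : ∀ (x : X.carrier) (f : X.carrier → ℂ), X.Reg f x →
    ∃ L : Matrix (Fin k) (Fin k) ℂ →ₗ[ℂ] ℂ, ∀ a : Matrix (Fin k) (Fin k) ℂ,
      HasDerivAt (fun t : ℂ => f (act (expGL (t • a)) x)) (L a) 0

/-- The infinitesimal action `χ : gl_k → T_x X`: `χ(a)_x` is the velocity at `t = 0` of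
the curve `t ↦ exp (t a) . x`, that is, `χ(a)_x f = d/dt f(exp (t a) . x)` at `t = 0`. -/
def HasInfAction.chi {k : ℕ} {X : FnSpace} {act : GL (Fin k) ℂ → X.carrier → X.carrier}
    (h : HasInfAction k X act) (x : X.carrier) :
    Matrix (Fin k) (Fin k) ℂ →ₗ[ℂ] X.Tangent x where
  toFun a :=
    ⟨{ toFun := fun f => _root_.deriv (fun t : ℂ => f.1 (act (expGL (t • a)) x)) 0
       map_add' := fun f g => by
         obtain ⟨L, hL⟩ := h.deriv x f.1 f.2
         obtain ⟨K, hK⟩ := h.deriv x g.1 g.2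
         exact ((hL a).add (hK a)).deriv.trans (by rw [(hL a).deriv, (hK a).deriv])
       map_smul' := fun c f => by
         obtain ⟨L, hL⟩ := h.deriv x f.1 f.2
         exact ((hL a).const_mul c).deriv.trans (by rw [(hL a).deriv]; rfl) },
      fun f g => by
        obtain ⟨L, hL⟩ := h.deriv x f.1 f.2
        obtain ⟨K, hK⟩ := h.deriv x g.1 g.2
        have e0 : act (expGL ((0 : ℂ) • a)) x = x := by
          have : expGL ((0 : ℂ) • a) = 1 := by
            ext1; simp [expGL]
          rw [this, h.one]
        refine ((hL a).mul (hK a)).deriv.trans ?_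
        simp only [e0]
        change _ = f.1 x * _root_.deriv _ 0 + g.1 x * _root_.deriv _ 0
        rw [(hL a).deriv, (hK a).deriv]
        ring⟩
  map_add' a b := by
    apply Subtype.ext
    apply LinearMap.ext
    intro f
    obtain ⟨L, hL⟩ := h.deriv x f.1 f.2
    change _root_.deriv (fun t : ℂ => f.1 (act (expGL (t • (a + b))) x)) 0 =
      _root_.deriv (fun t : ℂ => f.1 (act (expGL (t • a)) x)) 0 +
        _root_.deriv (fun t : ℂ => f.1 (act (expGL (t • b)) x)) 0
    rw [(hL (a + b)).deriv, (hL a).deriv, (hL b).deriv, map_add]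
  map_smul' c a := by
    apply Subtype.ext
    apply LinearMap.ext
    intro f
    obtain ⟨L, hL⟩ := h.deriv x f.1 f.2
    change _root_.deriv _ 0 = c * _root_.deriv _ 0
    rw [(hL (c • a)).deriv, (hL a).deriv, map_smul, smul_eq_mul]

/-- The extension of `χ` to bivectors: `χ(a ∧ b) = χ(a) ∧ χ(b)`. -/
def HasInfAction.chi₂ {k : ℕ} {X : FnSpace} {act : GL (Fin k) ℂ → X.carrier → X.carrier}
    (h : HasInfAction k X act) (r : ⋀[ℂ]^2 (Matrix (Fin k) (Fin k) ℂ)) (x : X.carrier) :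
    X.Bivector x :=
  exteriorPower.map 2 (h.chi x) r

/-- The standard `r`-matrix of `gl_k`: the sum of `E_{ij} ∧ E_{ji}` over `i < j`. -/
def rMatrix (k : ℕ) : ⋀[ℂ]^2 (Matrix (Fin k) (Fin k) ℂ) :=
  ∑ i : Fin k, ∑ j : Fin k,
    if i < j then wedge (Matrix.single i j (1 : ℂ)) (Matrix.single j i (1 : ℂ)) else 0

theorem expGL_hasDerivAt {k : ℕ} (a : Matrix (Fin k) (Fin k) ℂ) (i j : Fin k) :
    HasDerivAt (fun t : ℂ => (expGL (t • a)).1 i j) (a i j) 0 := by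
  let _ : NormedRing (Matrix (Fin k) (Fin k) ℂ) := Matrix.linftyOpNormedRing
  let _ : NormedAlgebra ℂ (Matrix (Fin k) (Fin k) ℂ) := Matrix.linftyOpNormedAlgebra
  have h := hasDerivAt_exp_smul_const (𝕂 := ℂ) a 0
  rw [zero_smul, NormedSpace.exp_zero, one_mul] at h
  have h2 := (LinearMap.toContinuousLinearMap
    (Matrix.entryLinearMap ℂ ℂ i j)).hasFDerivAt.comp_hasDerivAt (0 : ℂ) h
  exact h2

theorem expGL_mul_hasDerivAt {k l : ℕ} (a : Matrix (Fin k) (Fin k) ℂ)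
    (x : Matrix (Fin k) (Fin l) ℂ) (i : Fin k) (j : Fin l) :
    HasDerivAt (fun t : ℂ => ((expGL (t • a)).1 * x) i j) ((a * x) i j) 0 := by
  simp only [Matrix.mul_apply]
  exact HasDerivAt.fun_sum fun s _ => (expGL_hasDerivAt a i s).mul_const _

theorem expGL_zero_smul {k : ℕ} (a : Matrix (Fin k) (Fin k) ℂ) : expGL ((0 : ℂ) • a) = 1 := by
  ext1; simp [expGL]

/-- The action of `GL_m` on `M_{m,n}` by left multiplication has an infinitesimal action. -/
theorem leftAction (m n : ℕ) : HasInfAction m (matSpace m n)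
    (fun g (x : Matrix (Fin m) (Fin n) ℂ) => g.1 * x) where
  one x := Matrix.one_mul _
  deriv x f hf := by
    obtain ⟨L, hL⟩ := matSpace_hasDerivAt hf
    refine ⟨L ∘ₗ
      { toFun := fun a => a * x
        map_add' := fun a b => Matrix.add_mul a b _
        map_smul' := fun c a => Matrix.smul_mul c a _ }, fun a => ?_⟩
    refine hL (fun t => (expGL (t • a)).1 * x) (a * x) ?_ (expGL_mul_hasDerivAt a x)
    simp only [expGL_zero_smul]
    exact Matrix.one_mul _

/-- The action `g . x = x g⁻¹` of `GL_n` on `M_{m,n}` has an infinitesimal action. -/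
theorem rightAction (m n : ℕ) : HasInfAction n (matSpace m n)
    (fun g (x : Matrix (Fin m) (Fin n) ℂ) => x * (g⁻¹).1) where
  one x := by
    rw [inv_one]
    exact Matrix.mul_one _
  deriv x f hf := by
    obtain ⟨L, hL⟩ := matSpace_hasDerivAt hf
    refine ⟨-(L ∘ₗ
      { toFun := fun a => x * a
        map_add' := fun a b => Matrix.mul_add _ a b
        map_smul' := fun c a => Matrix.mul_smul _ c a }), fun a => ?_⟩
    have := hL (fun t : ℂ => (x : Matrix (Fin m) (Fin n) ℂ) * ((expGL (t • a))⁻¹).1) (-(x * a)) ?_ ?_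
    · simpa using this
    · simp only [expGL_zero_smul]
      simp
    · intro i j
      have e : ∀ t : ℂ, ((expGL (t • a))⁻¹).1 = (expGL (t • (-a))).1 := by
        intro t
        change NormedSpace.exp (-(t • a)) = NormedSpace.exp (t • (-a))
        rw [smul_neg]
      rw [← Matrix.mul_neg]
      simp only [e, Matrix.mul_apply]
      exact HasDerivAt.fun_sum fun s _ => (expGL_hasDerivAt (-a) s j).const_mul _

/-- The tangent vector `∂/∂x_{ij}` of `M_{m,n}` at `x`. -/
def partialAt {m n : ℕ} (i : Fin m) (j : Fin n) (x : Matrix (Fin m) (Fin n) ℂ) :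
    (matSpace m n).Tangent x :=
  have key : ∀ f : (matSpace m n).regAlg x, DifferentiableAt ℂ
      (fun t : ℂ => f.1 (x + t • Matrix.single i j 1)) 0 := fun f => by
    obtain ⟨L, hL⟩ := matSpace_hasDerivAt f.2
    refine (hL (fun t => x + t • Matrix.single i j 1) (Matrix.single i j 1) (by simp)
      fun p q => ?_).differentiableAt
    have := ((hasDerivAt_id (0 : ℂ)).mul_const (Matrix.single i j (1 : ℂ) p q)).const_add (x p q)
    rw [one_mul] at this
    exact this
  ⟨{ toFun := fun f => deriv (fun t : ℂ => f.1 (x + t • Matrix.single i j 1)) 0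
     map_add' := fun f g => deriv_add (key f) (key g)
     map_smul' := fun c f => deriv_const_mul c (key f) },
    fun f g => by
      refine (deriv_mul (key f) (key g)).trans ?_
      have e0 : x + (0 : ℂ) • Matrix.single i j 1 = x := by simp
      simp only [e0]
      change _ = f.1 x * deriv _ 0 + g.1 x * deriv _ 0
      ring⟩

/-- The standard quadratic Poisson structure `χ^R(r^n) - χ^L(r^m)` on `M_{m,n}`. -/
def matPoisson (m n : ℕ) (x : (matSpace m n).carrier) : (matSpace m n).Bivector x :=
  (rightAction m n).chi₂ (rMatrix n) x - (leftAction m n).chi₂ (rMatrix m) x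

/-- The same structure in coordinates: minus one half of the sum of
`(sign(k - i) + sign(l - j)) x_{il} x_{kj} ∂/∂x_{ij} ∧ ∂/∂x_{kl}` over all `i, k` and `j, l`. -/
def matPoissonCoord (m n : ℕ) (x : Matrix (Fin m) (Fin n) ℂ) : (matSpace m n).Bivector x :=
  -(1 / 2 : ℂ) • ∑ i : Fin m, ∑ k : Fin m, ∑ j : Fin n, ∑ l : Fin n,
    (((SignType.sign ((k : ℤ) - (i : ℤ)) : ℤ) + (SignType.sign ((l : ℤ) - (j : ℤ)) : ℤ) : ℤ) : ℂ)
      • (x i l * x k j) • wedge (partialAt i j x) (partialAt k l x)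

/-! ## The Grassmannian as a homogeneous space -/

/-- The general linear group as an open subvariety of the variety of matrices. -/
@[reducible] def glSpace (k : ℕ) : FnSpace :=
  (matSpace k k).induced (fun g : GL (Fin k) ℂ => (g.1 : Matrix (Fin k) (Fin k) ℂ))

/-- The invertible block triangular matrices (entries `i j` with `b j < b i` vanish). -/
def blockGroup {k : ℕ} (b : Fin k → ℕ) : Subgroup (GL (Fin k) ℂ) where
  carrier := {g | ∀ i j, b j < b i → g.1 i j = 0}
  one_mem' := by
    intro i j h
    exact Matrix.one_apply_ne (by rintro rfl; exact lt_irrefl _ h)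
  mul_mem' := by
    intro g h hg hh
    exact Matrix.BlockTriangular.mul (b := b) (fun i j => hg i j) (fun i j => hh i j)
  inv_mem' := by
    intro g hg
    have : Invertible (g.1 : Matrix (Fin k) (Fin k) ℂ) := g.invertible
    have := Matrix.blockTriangular_inv_of_blockTriangular (b := b) (M := g.1) (fun i j => hg i j)
    intro i j hij
    have h2 := this hij
    rwa [← Matrix.coe_units_inv] at h2

/-- The maximal parabolic subgroup `P_n` of `GL_{n+m}`: block upper triangular matrices with
diagonal blocks of sizes `n` and `m`. -/
def parabolic (m n : ℕ) : Subgroup (GL (Fin (n + m)) ℂ) :=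
  blockGroup (fun i => if (i : ℕ) < n then 0 else 1)

/-- The Borel subgroup `B⁻` of lower triangular matrices. -/
def lowerBorel (k : ℕ) : Subgroup (GL (Fin k) ℂ) :=
  blockGroup (fun i => k - (i : ℕ))

theorem mem_parabolic {m n : ℕ} {g : GL (Fin (n + m)) ℂ} :
    g ∈ parabolic m n ↔
      ∀ i j : Fin (n + m), n ≤ (i : ℕ) → (j : ℕ) < n → g.1 i j = 0 := by
  refine forall₂_congr fun i j => ⟨fun h hi hj => h ?_, fun h hij => h ?_ ?_⟩
  · simp [hj, hi.not_gt]
  · by_contra hi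
    simp [not_le.1 hi] at hij
  · by_contra hj
    simp only [hj, if_false] at hij
    split_ifs at hij <;> omega

theorem mem_lowerBorel {k : ℕ} {g : GL (Fin k) ℂ} :
    g ∈ lowerBorel k ↔ ∀ i j : Fin k, i < j → g.1 i j = 0 := by
  refine forall₂_congr fun i j => ⟨fun h hij => h ?_, fun h hij => h ?_⟩
  · have h1 : (i : ℕ) < j := hij
    change k - (j : ℕ) < k - (i : ℕ)
    omega
  · change k - (j : ℕ) < k - (i : ℕ) at hij
    have h1 : (i : ℕ) < j := by omega
    exact h1

/-- The Grassmannian `Gr(n, n+m)` as the homogeneous variety `GL_{n+m} / P_n`. -/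
@[reducible] def grassmannian (m n : ℕ) : FnSpace :=
  (glSpace (n + m)).quotient
    (fun g : GL (Fin (n + m)) ℂ => (g : GL (Fin (n + m)) ℂ ⧸ parabolic m n))

/-- The action of `GL_{n+m}` on the Grassmannian by left multiplication has an infinitesimal
action. -/
theorem grAction (m n : ℕ) : HasInfAction (n + m) (grassmannian m n)
    (fun g (x : GL (Fin (n + m)) ℂ ⧸ parabolic m n) => g • x) where
  one x := one_smul _ x
  deriv x f hf := by
    obtain ⟨U, -, hx, hU⟩ := hf
    obtain ⟨g, rfl⟩ := QuotientGroup.mk_surjective x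
    obtain ⟨F, hF, e⟩ := hU g hx
    obtain ⟨L, hL⟩ := matSpace_hasDerivAt hF
    refine ⟨L ∘ₗ
      { toFun := fun a => a * g.1
        map_add' := fun a b => Matrix.add_mul a b _
        map_smul' := fun c a => Matrix.smul_mul c a _ }, fun a => ?_⟩
    have hd := expGL_mul_hasDerivAt a g.1
    have e0 : (expGL ((0 : ℂ) • a)).1 * g.1 = g.1 := by
      rw [expGL_zero_smul]
      exact Matrix.one_mul _
    have h1 := hL (fun t => (expGL (t • a)).1 * g.1) (a * g.1) e0 hd
    refine h1.congr_of_eventuallyEq ?_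
    have ht : Filter.Tendsto (fun t : ℂ => (expGL (t • a)).1 * g.1) (𝓝 0)
        (@nhds _ (zariski (n + m) (n + m)) g.1) := by
      have := zariski_tendsto hd
      rwa [e0] at this
    have ht2 : Filter.Tendsto (fun t : ℂ => expGL (t • a) * g) (𝓝 0)
        (@nhds _ (glSpace (n + m)).top g) := by
      have hn : @nhds _ (glSpace (n + m)).top g = Filter.comap
          (fun g : GL (Fin (n + m)) ℂ => (g.1 : Matrix (Fin (n + m)) (Fin (n + m)) ℂ))
          (@nhds _ (zariski (n + m) (n + m)) g.1) :=
        @nhds_induced _ _ (zariski (n + m) (n + m)) _ g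
      rw [hn]
      exact Filter.tendsto_comap_iff.2 ht
    exact ht2.eventually e

/-- The bivector field `-χ(r^{n+m})` on the Grassmannian. -/
def grPoisson (m n : ℕ) (y : (grassmannian m n).carrier) : (grassmannian m n).Bivector y :=
  -(grAction m n).chi₂ (rMatrix (n + m)) y

/-- The orbit of the base point `P_n` of `GL_{n+m} / P_n` under `B⁻`. -/
def borelOrbit (m n : ℕ) : Set (GL (Fin (n + m)) ℂ ⧸ parabolic m n) :=
  MulAction.orbit (lowerBorel (n + m))
    ((1 : GL (Fin (n + m)) ℂ) : GL (Fin (n + m)) ℂ ⧸ parabolic m n)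

/-- The orbit `B⁻ . P_n`, as a subvariety of the Grassmannian. -/
@[reducible] def orbitSpace (m n : ℕ) : FnSpace :=
  (grassmannian m n).induced (fun y : borelOrbit m n => y.1)

/-- The matrix `[[1, 0], [y, 1]]` in `GL_{n+m}`. -/
def lowerUnipotent {m n : ℕ} (y : Matrix (Fin m) (Fin n) ℂ) : GL (Fin (n + m)) ℂ where
  val := Matrix.reindex finSumFinEquiv finSumFinEquiv (Matrix.fromBlocks 1 0 y 1)
  inv := Matrix.reindex finSumFinEquiv finSumFinEquiv (Matrix.fromBlocks 1 0 (-y) 1)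
  val_inv := by
    simp [Matrix.submatrix_mul_equiv, Matrix.fromBlocks_multiply]
  inv_val := by
    simp [Matrix.submatrix_mul_equiv, Matrix.fromBlocks_multiply]

/-- The permutation matrix `w_∘` of the longest element `i ↦ n + 1 - i` of `S_n`. -/
def longest (n : ℕ) : Matrix (Fin n) (Fin n) ℂ :=
  Matrix.of fun i j => if i = Fin.rev j then 1 else 0

/-- The map `x ↦ [[1, 0], [x w_∘, 1]] P_n` from `M_{m,n}` to `GL_{n+m} / P_n`. -/
def psi (m n : ℕ) (x : Matrix (Fin m) (Fin n) ℂ) : GL (Fin (n + m)) ℂ ⧸ parabolic m n :=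
  (lowerUnipotent (x * longest n) : GL (Fin (n + m)) ℂ)

end

noncomputable section

open FnSpace

/-! ## Generalities on spaces with functions -/

namespace FnSpace

variable {X Y Z : FnSpace}

/-! Everything is pulled back to linear algebra in the second exterior power of the space of
matrices. The map `velocity x` sends a matrix to the tangent vector at `x` that it defines; through
it the two actions on $M_{m,n}$ become $a\mapsto ax$ and $a\mapsto -xa$, and the sign of the latter
disappears on bivectors. Expanding $E_{ij}x$ and $xE_{ij}$ in matrix units expresses both images of
the $r$-matrices by the bivectors `exchange x a b`, which are antisymmetric in `a`, `b`; this gives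
the coordinate formula (`matPoisson_eq_coord`).

The bracket of two regular functions is therefore a sum of products of first partial derivatives
with the quadratic coefficients `coeff`. In the Jacobi identity the second derivatives cancel by
symmetry of the Hessians (`jacobi_of_coordinates`), which leaves the identity on coordinate
functions (`jacobi_coeff`). That one follows from a Yang-Baxter identity for signs, applied once to
the rows and once to the columns.

On the Grassmannian, $gP_n$ lies in the orbit iff the upper left block $A$ of $g$ is invertible, an
open condition, and there $CA^{-1}w_\circ$ inverts $\Psi$, where $C$ is the lower left block. In
this coordinate $\mathfrak{gl}_N$ acts by the quadratic vector fields `cellVelocity`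
(`grAction_chi_psi`). Their effect on $r^N$ splits by blocks (`map_cellVelocity_rMatrix`): the
$\mathfrak{gl}_m$ block gives the term from left multiplication, the $\mathfrak{gl}_n$ block gives
the term from right multiplication with its sign reversed by $w_\circ$, and the mixed terms add up
to zero by antisymmetry. Hence $\Psi$ carries $\pi^{m,n}$ to $-\chi(r^N)$.

An open inclusion is bijective on tangent spaces, so the restriction to the orbit exists and is
unique; it is Poisson because it corresponds to $\pi^{m,n}$ under an isomorphism. -/

theorem regAlg_coe {x : X.carrier} {f : X.carrier → ℂ} : f ∈ X.regAlg x ↔ X.Reg f x := Iff.rfl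

/-- Derivations at a point depend on germs only. -/
theorem tangent_congr {x : X.carrier} (D : X.Tangent x) {f g : X.regAlg x}
    (h : ∀ᶠ y in @nhds _ X.top x, f.1 y = g.1 y) : D.1 f = D.1 g := by
  classical
  let e : X.carrier → ℂ := fun y => if f.1 y = g.1 y then 0 else 1
  have he : X.Reg e x := by
    refine X.reg_congr ?_ (X.reg_const 0 x)
    filter_upwards [h] with y hy
    simp [e, hy]
  have hx : f.1 x = g.1 x := by
    let _ := X.top
    exact h.self_of_nhds
  have hk : (f - g) * ⟨e, he⟩ = f - g := by
    apply Subtype.ext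
    funext y
    change (f.1 y - g.1 y) * e y = f.1 y - g.1 y
    by_cases hy : f.1 y = g.1 y <;> simp [e, hy]
  have h1 := D.2 (f - g) ⟨e, he⟩
  rw [hk] at h1
  have h2 : (f - g).1 x = 0 := sub_eq_zero.2 hx
  have h3 : e x = 0 := by simp [e, hx]
  rw [h2] at h1
  change D.1 (f - g) = 0 * D.1 _ + e x * D.1 _ at h1
  rw [h3, zero_mul, zero_mul, add_zero, map_sub, sub_eq_zero] at h1
  exact h1

theorem tangent_ext {x : X.carrier} {D E : X.Tangent x}
    (h : ∀ f : X.regAlg x, D.1 f = E.1 f) : D = E :=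
  Subtype.ext (LinearMap.ext h)

theorem IsMorphism.comp {φ : X.carrier → Y.carrier} {ψ : Y.carrier → Z.carrier}
    (hψ : IsMorphism Y Z ψ) (hφ : IsMorphism X Y φ) : IsMorphism X Z (ψ ∘ φ) :=
  ⟨fun U hU => hφ.continuous _ (hψ.continuous U hU), fun x f hf => hφ.reg x _ (hψ.reg _ f hf)⟩

theorem IsMorphism.differential_comp {φ : X.carrier → Y.carrier} {ψ : Y.carrier → Z.carrier}
    (hψ : IsMorphism Y Z ψ) (hφ : IsMorphism X Y φ) (x : X.carrier) :
    (hψ.comp hφ).differential x = hψ.differential (φ x) ∘ₗ hφ.differential x := rfl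

/-- The equality with the identity is a hypothesis because the bivectors at `x` and at `φ x` have
different types. It is meant for composites such as `φ.symm ∘ φ`. -/
theorem IsMorphism.map_differential_of_eq_id {φ : X.carrier → X.carrier} (h : IsMorphism X X φ)
    (hφ : φ = _root_.id) (π : ∀ x, X.Bivector x) (x : X.carrier) :
    exteriorPower.map 2 (h.differential x) (π x) = π (φ x) := by
  subst hφ
  have : h.differential x = LinearMap.id := rfl
  rw [this, exteriorPower.map_id]
  rfl

theorem IsMorphism.eventually {φ : X.carrier → Y.carrier} (h : IsMorphism X Y φ) {x : X.carrier}
    {P : Y.carrier → Prop} (hP : ∀ᶠ y in @nhds _ Y.top (φ x), P y) :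
    ∀ᶠ x' in @nhds _ X.top x, P (φ x') := by
  let _ := X.top
  let _ := Y.top
  have : Continuous φ := ⟨h.continuous⟩
  exact this.continuousAt.eventually hP

/-! ### Open subspaces -/

theorem isMorphism_induced {S : Type} (i : S → X.carrier) : IsMorphism (X.induced i) X i where
  continuous U hU := ⟨U, hU, rfl⟩
  reg _ f hf := ⟨f, hf, Filter.Eventually.of_forall fun _ => rfl⟩

theorem isMorphism_to_induced {S : Type} {i : S → X.carrier} {φ : Y.carrier → S}
    (h : IsMorphism Y X (i ∘ φ)) : IsMorphism Y (X.induced i) φ where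
  continuous := by
    rintro _ ⟨V, hV, rfl⟩
    exact h.continuous V hV
  reg := by
    rintro y f ⟨F, hF, e⟩
    have hc : ∀ᶠ y' in @nhds _ Y.top y, f (φ y') = F (i (φ y')) := by
      let _ := Y.top
      let _ := X.top
      let _ : TopologicalSpace S := X.top.induced i
      have : Continuous (i ∘ φ) := ⟨h.continuous⟩
      exact (continuous_induced_rng.2 this).continuousAt.eventually e
    refine Y.reg_congr ?_ (h.reg y F hF)
    filter_upwards [hc] with y' hy'
    exact hy'.symm

/-- Every germ of a regular function on `S` is the pullback of a germ on `X`, and derivations only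
see germs. -/
theorem induced_differential_injective {S : Type} (i : S → X.carrier) (s : S) :
    Function.Injective ((isMorphism_induced (X := X) i).differential s) := by
  intro D E h
  refine tangent_ext fun f => ?_
  obtain ⟨F, hF, e⟩ := f.2
  have hF' : (X.induced i).Reg (F ∘ i) s := (isMorphism_induced i).reg s F hF
  have h1 : D.1 ⟨F ∘ i, hF'⟩ = E.1 ⟨F ∘ i, hF'⟩ :=
    congrArg (fun T : X.Tangent (i s) => T.1 ⟨F, hF⟩) h
  rw [tangent_congr D (g := ⟨F ∘ i, hF'⟩) e, tangent_congr E (g := ⟨F ∘ i, hF'⟩) e, h1]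

theorem reg_extend {S : Type} {i : S → X.carrier} (hi : Function.Injective i)
    (ho : X.Open (Set.range i)) {s : S} {f : S → ℂ} (hf : (X.induced i).Reg f s) :
    X.Reg (Function.extend i f 0) (i s) := by
  obtain ⟨F, hF, e⟩ := hf
  let _ := X.top
  let _ : TopologicalSpace S := X.top.induced i
  refine X.reg_congr ?_ hF
  rw [Filter.Eventually, nhds_induced, Filter.mem_comap] at e
  obtain ⟨V, hV, hVe⟩ := e
  filter_upwards [hV, IsOpen.mem_nhds ho ⟨s, rfl⟩] with y hy hy2
  obtain ⟨t, rfl⟩ := hy2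
  rw [hi.extend_apply]
  exact (hVe hy).symm

/-- Extension by zero respects sums, products and scalars and preserves regularity at points of the
open image. Composing a derivation of `X` with it therefore gives a derivation on `S`. -/
theorem induced_differential_surjective {S : Type} {i : S → X.carrier}
    (hi : Function.Injective i) (ho : X.Open (Set.range i)) (s : S) :
    Function.Surjective ((isMorphism_induced (X := X) i).differential s) := by
  intro D
  have hadd : ∀ f g : S → ℂ, Function.extend i (f + g) 0 =
      Function.extend i f 0 + Function.extend i g 0 := fun f g => by
    funext y
    by_cases hy : ∃ t, i t = y
    · obtain ⟨t, rfl⟩ := hy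
      simp [hi.extend_apply]
    · simp [Function.extend_apply' _ _ _ hy]
  have hmul : ∀ f g : S → ℂ, Function.extend i (f * g) 0 =
      Function.extend i f 0 * Function.extend i g 0 := fun f g => by
    funext y
    by_cases hy : ∃ t, i t = y
    · obtain ⟨t, rfl⟩ := hy
      simp [hi.extend_apply]
    · simp [Function.extend_apply' _ _ _ hy]
  have hsmul : ∀ (c : ℂ) (f : S → ℂ), Function.extend i (c • f) 0 =
      c • Function.extend i f 0 := fun c f => by
    funext y
    by_cases hy : ∃ t, i t = y
    · obtain ⟨t, rfl⟩ := hy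
      simp [hi.extend_apply]
    · simp [Function.extend_apply' _ _ _ hy]
  let E : (X.induced i).regAlg s → X.regAlg (i s) := fun f =>
    ⟨Function.extend i f.1 0, reg_extend hi ho f.2⟩
  refine ⟨⟨{ toFun := fun f => D.1 (E f), map_add' := ?_, map_smul' := ?_ }, ?_⟩, ?_⟩
  · intro f g
    rw [← map_add]
    exact congrArg D.1 (Subtype.ext (hadd f.1 g.1))
  · intro c f
    rw [RingHom.id_apply, ← map_smul]
    exact congrArg D.1 (Subtype.ext (hsmul c f.1))
  · intro f g
    have h1 := D.2 (E f) (E g)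
    have h2 : E (f * g) = E f * E g := Subtype.ext (hmul f.1 g.1)
    have h3 : ∀ f, (E f).1 (i s) = f.1 s := fun f => hi.extend_apply _ _ _
    rw [h3, h3] at h1
    change D.1 (E (f * g)) = f.1 s * D.1 (E g) + g.1 s * D.1 (E f)
    rw [h2, h1]
  · refine tangent_ext fun f => ?_
    -- Restricting and then extending by zero changes a function only off the open image.
    refine tangent_congr D ?_
    let _ := X.top
    filter_upwards [IsOpen.mem_nhds ho ⟨s, rfl⟩] with y hy
    obtain ⟨t, rfl⟩ := hy
    exact hi.extend_apply _ _ _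

theorem induced_map_differential_bijective {S : Type} {i : S → X.carrier}
    (hi : Function.Injective i) (ho : X.Open (Set.range i)) (s : S) :
    Function.Bijective
      (exteriorPower.map 2 ((isMorphism_induced (X := X) i).differential s)) :=
  ⟨exteriorPower.map_injective_field
      (induced_differential_injective i s),
    exteriorPower.map_surjective (induced_differential_surjective hi ho s)⟩

/-- The restriction of a bivector field to an open subspace. -/
def restrict {S : Type} {i : S → X.carrier} (hi : Function.Injective i)
    (ho : X.Open (Set.range i)) (π : ∀ x, X.Bivector x) (s : S) : (X.induced i).Bivector s :=
  ((induced_map_differential_bijective hi ho s).2 (π (i s))).choose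

theorem isPoissonMap_restrict {S : Type} {i : S → X.carrier} (hi : Function.Injective i)
    (ho : X.Open (Set.range i)) (π : ∀ x, X.Bivector x) :
    IsPoissonMap (X.induced i) X i (restrict hi ho π) π :=
  ⟨isMorphism_induced i, fun s =>
    ((induced_map_differential_bijective hi ho s).2 (π (i s))).choose_spec⟩

theorem eq_restrict {S : Type} {i : S → X.carrier} (hi : Function.Injective i)
    (ho : X.Open (Set.range i)) {π : ∀ x, X.Bivector x} {π' : ∀ s, (X.induced i).Bivector s}
    (h : IsPoissonMap (X.induced i) X i π' π) : π' = restrict hi ho π := by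
  obtain ⟨h1, h2⟩ := h
  obtain ⟨h3, h4⟩ := isPoissonMap_restrict hi ho π
  funext s
  exact (induced_map_differential_bijective hi ho s).1 ((h2 s).trans (h4 s).symm)

theorem IsPoissonMap.to_restrict {S : Type} {i : S → X.carrier} (hi : Function.Injective i)
    (ho : X.Open (Set.range i)) {π : ∀ x, X.Bivector x} {φ : Y.carrier → S}
    {ρ : ∀ y, Y.Bivector y} (h : IsPoissonMap Y X (i ∘ φ) ρ π) :
    IsPoissonMap Y (X.induced i) φ ρ (restrict hi ho π) := by
  obtain ⟨h1, h2⟩ := h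
  obtain ⟨h3, h4⟩ := isPoissonMap_restrict hi ho π
  refine ⟨isMorphism_to_induced h1, fun y => ?_⟩
  refine (induced_map_differential_bijective hi ho (φ y)).1 ?_
  refine Eq.trans ?_ ((h2 y).trans (h4 (φ y)).symm)
  exact (LinearMap.congr_fun (exteriorPower.map_comp _ _) (ρ y)).symm

/-! ### Brackets -/

theorem pairing_wedge_wedge {M : Type*} [AddCommGroup M] [Module ℂ M] (a b : Module.Dual ℂ M)
    (u v : M) : exteriorPower.pairingDual ℂ M 2 (wedge a b) (wedge u v) = a u * b v - b u * a v := by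
  simp [wedge, Matrix.det_fin_two]

theorem pairing_wedge_map {M N : Type*} [AddCommGroup M] [Module ℂ M] [AddCommGroup N]
    [Module ℂ N] (φ : M →ₗ[ℂ] N) {a b : Module.Dual ℂ N} {a' b' : Module.Dual ℂ M}
    (ha : a ∘ₗ φ = a') (hb : b ∘ₗ φ = b') (B : ⋀[ℂ]^2 M) :
    exteriorPower.pairingDual ℂ N 2 (wedge a b) (exteriorPower.map 2 φ B) =
      exteriorPower.pairingDual ℂ M 2 (wedge a' b') B := by
  subst ha hb
  have : exteriorPower.pairingDual ℂ N 2 (wedge a b) ∘ₗ exteriorPower.map 2 φ =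
      exteriorPower.pairingDual ℂ M 2 (wedge (a ∘ₗ φ) (b ∘ₗ φ)) := by
    apply exteriorPower.linearMap_ext
    ext v
    simp [wedge, Matrix.det_fin_two]
  exact LinearMap.congr_fun this B

theorem bracket_eq (π : ∀ x, X.Bivector x) {f g : X.carrier → ℂ} {x : X.carrier}
    (hf : X.Reg f x) (hg : X.Reg g x) : X.bracket π f g x =
      exteriorPower.pairingDual ℂ (X.Tangent x) 2
        (wedge (X.dfun x ⟨f, hf⟩) (X.dfun x ⟨g, hg⟩)) (π x) := by
  rw [bracket, dif_pos ⟨hf, hg⟩]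

theorem bracket_eq_zero (π : ∀ x, X.Bivector x) {f g : X.carrier → ℂ} {x : X.carrier}
    (h : ¬ (X.Reg f x ∧ X.Reg g x)) : X.bracket π f g x = 0 := by
  rw [bracket, dif_neg h]

theorem IsMorphism.dfun_comp_differential {φ : X.carrier → Y.carrier} (h : IsMorphism X Y φ)
    (x : X.carrier) {f : Y.carrier → ℂ} (hf : Y.Reg f (φ x)) :
    Y.dfun (φ x) ⟨f, hf⟩ ∘ₗ h.differential x = X.dfun x ⟨f ∘ φ, h.reg x f hf⟩ := rfl

theorem IsPoissonMap.bracket_comp {φ : X.carrier → Y.carrier} {π : ∀ x, X.Bivector x}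
    {π' : ∀ y, Y.Bivector y} (h : IsPoissonMap X Y φ π π') {f g : Y.carrier → ℂ} {x : X.carrier}
    (hf : Y.Reg f (φ x)) (hg : Y.Reg g (φ x)) :
    X.bracket π (f ∘ φ) (g ∘ φ) x = Y.bracket π' f g (φ x) := by
  obtain ⟨hφ, hπ⟩ := h
  have h1 := pairing_wedge_map (hφ.differential x) (hφ.dfun_comp_differential x hf)
    (hφ.dfun_comp_differential x hg) (π x)
  rw [hπ] at h1
  exact ((bracket_eq π (hφ.reg x f hf) (hφ.reg x g hg)).trans h1.symm).trans
    (bracket_eq π' hf hg).symm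

theorem IsPoissonIso.reg_iff {φ : X.carrier ≃ Y.carrier} {π : ∀ x, X.Bivector x}
    {π' : ∀ y, Y.Bivector y} (h : IsPoissonIso X Y φ π π') {f : Y.carrier → ℂ} {x : X.carrier} :
    X.Reg (f ∘ φ) x ↔ Y.Reg f (φ x) := by
  refine ⟨fun hf => ?_, h.1.1.reg x f⟩
  have := h.2.1.reg (φ x) (f ∘ φ) (by simpa using hf)
  simpa [Function.comp_assoc] using this

/-- The equality holds at all points, also where the bracket takes its default value `0`, since
regularity corresponds under `φ`. It can thus be substituted inside an iterated bracket. -/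
theorem IsPoissonIso.bracket_comp {φ : X.carrier ≃ Y.carrier} {π : ∀ x, X.Bivector x}
    {π' : ∀ y, Y.Bivector y} (h : IsPoissonIso X Y φ π π') (f g : Y.carrier → ℂ) :
    Y.bracket π' f g ∘ φ = X.bracket π (f ∘ φ) (g ∘ φ) := by
  funext x
  by_cases hfg : Y.Reg f (φ x) ∧ Y.Reg g (φ x)
  · exact (h.1.bracket_comp hfg.1 hfg.2).symm
  · have h2 : ¬ (X.Reg (f ∘ φ) x ∧ X.Reg (g ∘ φ) x) := fun h3 =>
      hfg ⟨h.reg_iff.1 h3.1, h.reg_iff.1 h3.2⟩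
    exact (bracket_eq_zero π' hfg).trans (bracket_eq_zero π h2).symm

theorem IsPoissonIso.isPoisson {φ : X.carrier ≃ Y.carrier} {π : ∀ x, X.Bivector x}
    {π' : ∀ y, Y.Bivector y} (h : IsPoissonIso X Y φ π π') (hX : X.IsPoisson π) :
    Y.IsPoisson π' where
  regular U hU f g hf hg y hy := by
    obtain ⟨x, rfl⟩ := φ.surjective y
    rw [← h.reg_iff, h.bracket_comp]
    exact hX.regular (φ ⁻¹' U) (h.1.1.continuous U hU) _ _
      (fun x hx => h.reg_iff.2 (hf _ hx)) (fun x hx => h.reg_iff.2 (hg _ hx)) x hy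
  jacobi U hU f g k hf hg hk y hy := by
    obtain ⟨x, rfl⟩ := φ.surjective y
    have key : ∀ p q r : Y.carrier → ℂ, Y.bracket π' p (Y.bracket π' q r) (φ x) =
        X.bracket π (p ∘ φ) (X.bracket π (q ∘ φ) (r ∘ φ)) x := fun p q r => by
      rw [← h.bracket_comp q r, ← h.bracket_comp]
      rfl
    rw [key, key, key]
    exact hX.jacobi (φ ⁻¹' U) (h.1.1.continuous U hU) _ _ _
      (fun x hx => h.reg_iff.2 (hf _ hx)) (fun x hx => h.reg_iff.2 (hg _ hx))
      (fun x hx => h.reg_iff.2 (hk _ hx)) x hy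

/-- A bijective Poisson map whose inverse is a morphism is a Poisson isomorphism. -/
theorem IsPoissonMap.isPoissonIso {φ : X.carrier ≃ Y.carrier} {π : ∀ x, X.Bivector x}
    {π' : ∀ y, Y.Bivector y} (h : IsPoissonMap X Y φ π π') (h' : IsMorphism Y X φ.symm) :
    IsPoissonIso X Y φ π π' := by
  refine ⟨h, h', fun y => ?_⟩
  obtain ⟨x, rfl⟩ := φ.surjective y
  obtain ⟨hφ, hπ⟩ := h
  -- By the chain rule the differential of the inverse undoes that of `φ`, so the inverse is
  -- automatically Poisson.
  have key := (h'.comp hφ).map_differential_of_eq_id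
    (funext fun x => φ.symm_apply_apply x) π x
  rw [IsMorphism.differential_comp h' hφ, exteriorPower.map_comp, LinearMap.comp_apply, hπ] at key
  exact key

/-! ### Inverses of regular functions -/

/-- The nonvanishing locus of a regular function is open, and its inverse is regular there. -/
def HasInverses (X : FnSpace) : Prop :=
  ∀ (f : X.carrier → ℂ) (x : X.carrier), X.Reg f x → f x ≠ 0 →
    X.Reg f⁻¹ x ∧ ∀ᶠ y in @nhds _ X.top x, f y ≠ 0

theorem HasInverses.induced (hX : X.HasInverses) {S : Type} (i : S → X.carrier) :
    (X.induced i).HasInverses := by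
  rintro f s ⟨F, hF, e⟩ hf
  have h0 : f s = F (i s) := by
    let _ := X.top
    let _ : TopologicalSpace S := X.top.induced i
    exact e.self_of_nhds
  obtain ⟨h1, h2⟩ := hX F (i s) hF (h0 ▸ hf)
  refine ⟨⟨F⁻¹, h1, ?_⟩, ?_⟩
  · filter_upwards [e] with y hy
    simp [hy]
  · filter_upwards [e, (isMorphism_induced i).eventually h2] with y hy hy2
    rwa [hy]

theorem HasInverses.quotient (hX : X.HasInverses) {Q : Type} (p : X.carrier → Q) :
    (X.quotient p).HasInverses := by
  rintro f q ⟨U, hU, hq, hf⟩ hfq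
  let _ := X.top
  let _ : TopologicalSpace Q := X.top.coinduced p
  have ho : IsOpen (p ⁻¹' (U ∩ {q | f q ≠ 0})) := by
    rw [isOpen_iff_mem_nhds]
    intro x hx
    filter_upwards [IsOpen.mem_nhds hU hx.1, (hX _ x (hf x hx.1) hx.2).2] with y h1 h2
    exact ⟨h1, h2⟩
  refine ⟨⟨_, ho, ⟨hq, hfq⟩, fun x hx => (hX _ x (hf x hx.1) hx.2).1⟩, ?_⟩
  have ho2 : IsOpen (U ∩ {q | f q ≠ 0}) := isOpen_coinduced.2 ho
  filter_upwards [ho2.mem_nhds ⟨hq, hfq⟩] with y hy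
  exact hy.2

theorem isMorphism_quotient {Q : Type} (p : X.carrier → Q) :
    IsMorphism X (X.quotient p) p where
  continuous U hU := hU
  reg := by
    rintro x f ⟨U, -, hx, hf⟩
    exact hf x hx

theorem hasInverses_matSpace (m n : ℕ) : (matSpace m n).HasInverses := by
  rintro f A ⟨p, q, hq, e⟩ hf
  have hp : evalMat p A ≠ 0 := fun h => hf (by rw [e A hq, h, zero_div])
  have hpq : ∀ B, evalMat (p * q) B ≠ 0 → evalMat p B ≠ 0 ∧ evalMat q B ≠ 0 := fun B hB => by
    simpa [evalMat] using hB
  have hpqA : evalMat (p * q) A ≠ 0 := by simpa [evalMat] using And.intro hp hq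
  refine ⟨⟨q * q, p * q, hpqA, fun B hB => ?_⟩, ?_⟩
  · obtain ⟨h1, h2⟩ := hpq B hB
    rw [Pi.inv_apply, e B h2]
    simp only [evalMat, map_mul] at h1 h2 ⊢
    field_simp
  · refine zariski_eventually.2 ⟨p * q, hpqA, fun B hB => ?_⟩
    obtain ⟨h1, h2⟩ := hpq B hB
    rw [e B h2]
    exact div_ne_zero h1 h2

/-- A map to a variety of matrices is a morphism if its entries are regular. -/
theorem isMorphism_to_matSpace (hX : X.HasInverses) {k l : ℕ}
    {φ : X.carrier → Matrix (Fin k) (Fin l) ℂ}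
    (hφ : ∀ x i j, X.Reg (fun y => φ y i j) x) : IsMorphism X (matSpace k l) φ := by
  have hp : ∀ (p : MvPolynomial (Fin k × Fin l) ℂ) (x : X.carrier),
      X.Reg (fun y => evalMat p (φ y)) x := by
    intro p x
    induction p using MvPolynomial.induction_on with
    | C a => simpa [evalMat] using X.reg_const a x
    | add p q hp hq =>
      simp only [evalMat, map_add] at hp hq ⊢
      exact X.reg_add hp hq
    | mul_X p ij hp =>
      simp only [evalMat, map_mul, MvPolynomial.eval_X] at hp ⊢
      exact X.reg_mul hp (hφ x ij.1 ij.2)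
  constructor
  · intro U hU
    let _ := X.top
    refine isOpen_iff_mem_nhds.2 fun x hx => ?_
    obtain ⟨p, h1, h2⟩ := hU (φ x) hx
    filter_upwards [(hX _ x (hp p x) h1).2] with y hy
    exact h2 _ hy
  · rintro x f ⟨p, q, hq, e⟩
    obtain ⟨h1, h2⟩ := hX _ x (hp q x) hq
    refine X.reg_congr ?_ (X.reg_mul (hp p x) h1)
    filter_upwards [h2] with y hy
    rw [Function.comp_apply, e _ hy]
    rfl

end FnSpace

/-! ## The Jacobi identity for brackets given by a matrix of coefficients -/

section JacobiSum

variable {ι : Type*} [Fintype ι]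

theorem sum_hessian_comm {M : ι → ι → ℂ} (hM : ∀ a b, M a b = M b a) (u v : ι → ℂ) :
    ∑ d, ∑ b, u d * v b * M d b = ∑ d, ∑ b, v d * u b * M d b := by
  rw [Finset.sum_comm]
  refine Finset.sum_congr rfl fun d _ => Finset.sum_congr rfl fun b _ => ?_
  rw [hM b d]; ring

/-- This is $\{f,\{g,h\}\}$ expanded by the Leibniz rule: one term with first derivatives only, and
the Hessians of $g$ and $h$ evaluated on pairs of Hamiltonian vectors. Antisymmetry of `P` puts the
Hamiltonian vector of $h$ in the same form as the others, at the cost of a sign. -/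
theorem iterated_bracket_eq {P : ι → ι → ℂ} (hP : ∀ a b, P a b = -P b a)
    (dP : ι → ι → ι → ℂ) (f g h : ι → ℂ) (G H : ι → ι → ℂ) :
    (∑ a, ∑ d, P a d * f a * ∑ b, ∑ c,
      (dP d b c * g b * h c + P b c * G d b * h c + P b c * g b * H d c)) =
    (∑ a, ∑ b, ∑ c, f a * g b * h c * ∑ d, P a d * dP d b c)
      - (∑ d, ∑ b, (∑ a, P a d * f a) * (∑ c, P c b * h c) * G d b)
      + ∑ d, ∑ c, (∑ a, P a d * f a) * (∑ b, P b c * g b) * H d c := by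
  have e1 : (∑ a, ∑ d, P a d * f a * ∑ b, ∑ c, dP d b c * g b * h c) =
      ∑ a, ∑ b, ∑ c, f a * g b * h c * ∑ d, P a d * dP d b c := by
    refine Finset.sum_congr rfl fun a _ => ?_
    simp only [Finset.mul_sum]
    rw [Finset.sum_comm]
    refine Finset.sum_congr rfl fun b _ => ?_
    rw [Finset.sum_comm]
    refine Finset.sum_congr rfl fun c _ => Finset.sum_congr rfl fun d _ => ?_
    ring
  have e2 : (∑ a, ∑ d, P a d * f a * ∑ b, ∑ c, P b c * G d b * h c) =
      -∑ d, ∑ b, (∑ a, P a d * f a) * (∑ c, P c b * h c) * G d b := by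
    rw [Finset.sum_comm, ← Finset.sum_neg_distrib]
    refine Finset.sum_congr rfl fun d _ => ?_
    rw [← Finset.sum_mul, ← Finset.sum_neg_distrib, Finset.mul_sum]
    refine Finset.sum_congr rfl fun b _ => ?_
    have : ∑ c, P b c * G d b * h c = -((∑ c, P c b * h c) * G d b) := by
      rw [Finset.sum_mul, ← Finset.sum_neg_distrib]
      refine Finset.sum_congr rfl fun c _ => ?_
      rw [hP b c]; ring
    rw [this]; ring
  have e3 : (∑ a, ∑ d, P a d * f a * ∑ b, ∑ c, P b c * g b * H d c) =
      ∑ d, ∑ c, (∑ a, P a d * f a) * (∑ b, P b c * g b) * H d c := by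
    rw [Finset.sum_comm]
    refine Finset.sum_congr rfl fun d _ => ?_
    rw [← Finset.sum_mul, Finset.sum_comm, Finset.mul_sum]
    refine Finset.sum_congr rfl fun c _ => ?_
    rw [← Finset.sum_mul, mul_assoc]
  simp only [Finset.sum_add_distrib, mul_add]
  rw [e1, e2, e3]
  ring

/-- If the coefficients `P` with partial derivatives `dP` satisfy the Jacobi identity on
coordinates, then the Jacobi identity holds for functions with gradients `f, g, h` and (symmetric)
Hessians `F, G, H`. -/
theorem jacobi_of_coordinates {P : ι → ι → ℂ} (hP : ∀ a b, P a b = -P b a)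
    {dP : ι → ι → ι → ℂ}
    (hJ : ∀ a b c, (∑ d, P a d * dP d b c) + (∑ d, P b d * dP d c a)
      + (∑ d, P c d * dP d a b) = 0)
    (f g h : ι → ℂ) {F G H : ι → ι → ℂ} (hF : ∀ a b, F a b = F b a) (hG : ∀ a b, G a b = G b a)
    (hH : ∀ a b, H a b = H b a) :
    (∑ a, ∑ d, P a d * f a * ∑ b, ∑ c,
      (dP d b c * g b * h c + P b c * G d b * h c + P b c * g b * H d c)) +
    (∑ a, ∑ d, P a d * g a * ∑ b, ∑ c,
      (dP d b c * h b * f c + P b c * H d b * f c + P b c * h b * F d c)) +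
    (∑ a, ∑ d, P a d * h a * ∑ b, ∑ c,
      (dP d b c * f b * g c + P b c * F d b * g c + P b c * f b * G d c)) = 0 := by
  rw [iterated_bracket_eq hP, iterated_bracket_eq hP, iterated_bracket_eq hP]
  have hA : (∑ a, ∑ b, ∑ c, f a * g b * h c * ∑ d, P a d * dP d b c) +
      (∑ a, ∑ b, ∑ c, g a * h b * f c * ∑ d, P a d * dP d b c) +
      (∑ a, ∑ b, ∑ c, h a * f b * g c * ∑ d, P a d * dP d b c) = 0 := by
    have e2 : (∑ a, ∑ b, ∑ c, g a * h b * f c * ∑ d, P a d * dP d b c) =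
        ∑ a, ∑ b, ∑ c, f a * g b * h c * ∑ d, P b d * dP d c a := by
      symm
      rw [Finset.sum_comm]
      refine Finset.sum_congr rfl fun b _ => ?_
      rw [Finset.sum_comm]
      refine Finset.sum_congr rfl fun c _ => Finset.sum_congr rfl fun a _ => ?_
      ring
    have e3 : (∑ a, ∑ b, ∑ c, h a * f b * g c * ∑ d, P a d * dP d b c) =
        ∑ a, ∑ b, ∑ c, f a * g b * h c * ∑ d, P c d * dP d a b := by
      rw [Finset.sum_comm]
      refine Finset.sum_congr rfl fun a _ => ?_
      rw [Finset.sum_comm]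
      refine Finset.sum_congr rfl fun b _ => Finset.sum_congr rfl fun c _ => ?_
      ring
    rw [e2, e3]
    simp only [← Finset.sum_add_distrib]
    refine Finset.sum_eq_zero fun a _ => Finset.sum_eq_zero fun b _ =>
      Finset.sum_eq_zero fun c _ => ?_
    rw [← mul_add, ← mul_add, hJ, mul_zero]
  -- Each Hessian occurs twice, with opposite signs and exchanged arguments.
  rw [sum_hessian_comm hF (fun d => ∑ a, P a d * g a),
    sum_hessian_comm hG (fun d => ∑ a, P a d * h a),
    sum_hessian_comm hH (fun d => ∑ a, P a d * f a)]
  linear_combination hA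

end JacobiSum

/-! ## Calculus on the variety of matrices -/

section Calculus

variable {m n : ℕ}

theorem hasDerivAt_line (x V : Matrix (Fin m) (Fin n) ℂ) (i : Fin m) (j : Fin n) :
    HasDerivAt (fun t : ℂ => (x + t • V) i j) (V i j) 0 := by
  have := ((hasDerivAt_id (0 : ℂ)).mul_const (V i j)).const_add (x i j)
  rw [one_mul] at this
  exact this

theorem hasDerivAt_of_reg {f : Matrix (Fin m) (Fin n) ℂ → ℂ} {x : Matrix (Fin m) (Fin n) ℂ}
    (hf : (matSpace m n).Reg f x) : ∃ L : Matrix (Fin m) (Fin n) ℂ →ₗ[ℂ] ℂ,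
      ∀ V, HasDerivAt (fun t : ℂ => f (x + t • V)) (L V) 0 := by
  obtain ⟨L, hL⟩ := matSpace_hasDerivAt hf
  exact ⟨L, fun V => hL _ V (by simp) (hasDerivAt_line x V)⟩

/-- The velocity of the line `t ↦ x + t V` at `t = 0`. -/
def velocity (x : Matrix (Fin m) (Fin n) ℂ) :
    Matrix (Fin m) (Fin n) ℂ →ₗ[ℂ] (matSpace m n).Tangent x where
  toFun V := ⟨{
      toFun := fun f => deriv (fun t : ℂ => f.1 (x + t • V)) 0
      map_add' := fun f g => by
        obtain ⟨L, hL⟩ := hasDerivAt_of_reg f.2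
        obtain ⟨K, hK⟩ := hasDerivAt_of_reg g.2
        exact deriv_add (hL V).differentiableAt (hK V).differentiableAt
      map_smul' := fun c f => by
        obtain ⟨L, hL⟩ := hasDerivAt_of_reg f.2
        exact deriv_const_mul c (hL V).differentiableAt }, fun f g => by
    obtain ⟨L, hL⟩ := hasDerivAt_of_reg f.2
    obtain ⟨K, hK⟩ := hasDerivAt_of_reg g.2
    refine (deriv_mul (hL V).differentiableAt (hK V).differentiableAt).trans ?_
    have e0 : x + (0 : ℂ) • V = x := by simp
    simp only [e0]
    change _ = f.1 x * deriv _ 0 + g.1 x * deriv _ 0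
    ring⟩
  map_add' V W := tangent_ext fun f => by
    obtain ⟨L, hL⟩ := hasDerivAt_of_reg f.2
    change deriv (fun t : ℂ => f.1 (x + t • (V + W))) 0 =
      deriv (fun t : ℂ => f.1 (x + t • V)) 0 + deriv (fun t : ℂ => f.1 (x + t • W)) 0
    rw [(hL _).deriv, (hL _).deriv, (hL _).deriv, map_add]
  map_smul' c V := tangent_ext fun f => by
    obtain ⟨L, hL⟩ := hasDerivAt_of_reg f.2
    change deriv (fun t : ℂ => f.1 (x + t • c • V)) 0 =
      c * deriv (fun t : ℂ => f.1 (x + t • V)) 0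
    rw [(hL _).deriv, (hL _).deriv, map_smul, smul_eq_mul]

/-- The partial derivative `∂f/∂x_a`. -/
def pd (a : Fin m × Fin n) (f : Matrix (Fin m) (Fin n) ℂ → ℂ) (x : Matrix (Fin m) (Fin n) ℂ) : ℂ :=
  deriv (fun t : ℂ => f (x + t • Matrix.single a.1 a.2 1)) 0

theorem differentiableAt_line {f : Matrix (Fin m) (Fin n) ℂ → ℂ} {x : Matrix (Fin m) (Fin n) ℂ}
    (hf : (matSpace m n).Reg f x) (V : Matrix (Fin m) (Fin n) ℂ) :
    DifferentiableAt ℂ (fun t : ℂ => f (x + t • V)) 0 :=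
  (hasDerivAt_of_reg hf).elim fun _ h => (h V).differentiableAt

theorem pd_mul (a : Fin m × Fin n) {f g : Matrix (Fin m) (Fin n) ℂ → ℂ}
    {x : Matrix (Fin m) (Fin n) ℂ} (hf : (matSpace m n).Reg f x) (hg : (matSpace m n).Reg g x) :
    pd a (fun y => f y * g y) x = pd a f x * g x + f x * pd a g x := by
  have := deriv_fun_mul (differentiableAt_line hf (Matrix.single a.1 a.2 1))
    (differentiableAt_line hg (Matrix.single a.1 a.2 1))
  simp only [zero_smul, add_zero] at this
  exact this

theorem pd_sum {κ : Type*} [Fintype κ] (a : Fin m × Fin n)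
    {f : κ → Matrix (Fin m) (Fin n) ℂ → ℂ} {x : Matrix (Fin m) (Fin n) ℂ}
    (hf : ∀ k, (matSpace m n).Reg (f k) x) :
    pd a (fun y => ∑ k, f k y) x = ∑ k, pd a (f k) x :=
  deriv_fun_sum fun k _ => differentiableAt_line (hf k) _

/-- A line is continuous at `0` for the Zariski topology, so agreement on a Zariski neighbourhood is
enough. -/
theorem pd_congr (a : Fin m × Fin n) {f g : Matrix (Fin m) (Fin n) ℂ → ℂ}
    {x : Matrix (Fin m) (Fin n) ℂ} (h : ∀ᶠ y in @nhds _ (zariski m n) x, f y = g y) :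
    pd a f x = pd a g x := by
  have ht := zariski_tendsto (hasDerivAt_line x (Matrix.single a.1 a.2 1))
  rw [zero_smul, add_zero] at ht
  exact Filter.EventuallyEq.deriv_eq (ht.eventually h)

/-- Identifies the analytic partial derivative with the formal one, so that regularity and
commutation of partial derivatives become statements about polynomials. -/
theorem hasDerivAt_evalMat (p : MvPolynomial (Fin m × Fin n) ℂ) (a : Fin m × Fin n)
    (x : Matrix (Fin m) (Fin n) ℂ) :
    HasDerivAt (fun t : ℂ => evalMat p (x + t • Matrix.single a.1 a.2 1))
      (evalMat (MvPolynomial.pderiv a p) x) 0 := by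
  induction p using MvPolynomial.induction_on with
  | C c => simpa [evalMat] using hasDerivAt_const (0 : ℂ) c
  | add p q hp hq =>
    simp only [evalMat, map_add] at hp hq ⊢
    exact hp.fun_add hq
  | mul_X p b hp =>
    have h1 := hp.fun_mul (hasDerivAt_line x (Matrix.single a.1 a.2 1) b.1 b.2)
    have e1 : Matrix.single a.1 a.2 (1 : ℂ) b.1 b.2 = if b = a then 1 else 0 := by
      rw [Matrix.single_apply]
      refine if_congr ?_ rfl rfl
      rw [Prod.ext_iff, eq_comm, @eq_comm _ a.2]
    rw [e1, zero_smul, add_zero] at h1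
    have e2 : (fun t : ℂ => evalMat (p * MvPolynomial.X b) (x + t • Matrix.single a.1 a.2 1)) =
        fun t : ℂ => evalMat p (x + t • Matrix.single a.1 a.2 1)
          * (x + t • Matrix.single a.1 a.2 1 : Matrix (Fin m) (Fin n) ℂ) b.1 b.2 := by
      funext t
      simp only [evalMat, map_mul, MvPolynomial.eval_X]
    rw [e2]
    refine h1.congr_deriv ?_
    rw [MvPolynomial.pderiv_mul, MvPolynomial.pderiv_X]
    by_cases hab : b = a
    · subst hab
      simp [evalMat]
    · simp [evalMat, hab]

/-- The quotient rule holds on the whole locus where `q` does not vanish, so the derivative is again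
given by one fraction there and the lemma can be iterated. -/
theorem pd_rational {p q : MvPolynomial (Fin m × Fin n) ℂ}
    {f : Matrix (Fin m) (Fin n) ℂ → ℂ}
    (hf : ∀ B, evalMat q B ≠ 0 → f B = evalMat p B / evalMat q B) (a : Fin m × Fin n)
    {B : Matrix (Fin m) (Fin n) ℂ} (hB : evalMat q B ≠ 0) :
    pd a f B = evalMat (MvPolynomial.pderiv a p * q - p * MvPolynomial.pderiv a q) B
      / evalMat (q * q) B := by
  have h1 : pd a f B = pd a (fun B => evalMat p B / evalMat q B) B :=
    pd_congr a (zariski_eventually.2 ⟨q, hB, hf⟩)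
  have h2 := (hasDerivAt_evalMat p a B).fun_div (hasDerivAt_evalMat q a B) (by simpa using hB)
  rw [h1, pd, h2.deriv]
  simp [evalMat, pow_two]

theorem reg_pd (a : Fin m × Fin n) {f : Matrix (Fin m) (Fin n) ℂ → ℂ}
    {x : Matrix (Fin m) (Fin n) ℂ} (hf : (matSpace m n).Reg f x) :
    (matSpace m n).Reg (pd a f) x := by
  obtain ⟨p, q, hq, e⟩ := hf
  have hqq : ∀ B, evalMat (q * q) B ≠ 0 ↔ evalMat q B ≠ 0 := fun B => by simp [evalMat]
  exact ⟨_, q * q, (hqq x).2 hq, fun B hB => pd_rational e a ((hqq B).1 hB)⟩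

theorem pderiv_comm {σ : Type*} (a b : σ) (p : MvPolynomial σ ℂ) :
    MvPolynomial.pderiv a (MvPolynomial.pderiv b p) =
      MvPolynomial.pderiv b (MvPolynomial.pderiv a p) := by
  classical
  -- A commutator of derivations is a derivation, so it suffices that it kills the variables.
  have : ⁅MvPolynomial.pderiv (R := ℂ) a, MvPolynomial.pderiv (R := ℂ) b⁆ = 0 := by
    refine MvPolynomial.derivation_ext fun i => ?_
    rw [Derivation.commutator_apply, MvPolynomial.pderiv_X, MvPolynomial.pderiv_X]
    by_cases h1 : a = i <;> by_cases h2 : b = i <;> simp [*]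
  have h := congrArg (fun D => D p) this
  simp only [Derivation.commutator_apply] at h
  exact sub_eq_zero.1 h

theorem pd_comm (a b : Fin m × Fin n) {f : Matrix (Fin m) (Fin n) ℂ → ℂ}
    {x : Matrix (Fin m) (Fin n) ℂ} (hf : (matSpace m n).Reg f x) :
    pd a (pd b f) x = pd b (pd a f) x := by
  obtain ⟨p, q, hq, e⟩ := hf
  have hqq : ∀ B, evalMat (q * q) B ≠ 0 ↔ evalMat q B ≠ 0 := fun B => by simp [evalMat]
  have h1 := pd_rational (fun B hB => pd_rational e b ((hqq B).1 hB)) a ((hqq x).2 hq)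
  have h2 := pd_rational (fun B hB => pd_rational e a ((hqq B).1 hB)) b ((hqq x).2 hq)
  rw [h1, h2]
  refine congrArg (fun r => evalMat r x / _) ?_
  simp only [MvPolynomial.pderiv_mul, map_sub]
  rw [pderiv_comm a b p, pderiv_comm a b q]
  ring

theorem reg_entry (i : Fin m) (j : Fin n) (x : Matrix (Fin m) (Fin n) ℂ) :
    (matSpace m n).Reg (fun y => y i j) x :=
  ⟨MvPolynomial.X (i, j), 1, by simp [evalMat], fun B _ => by simp [evalMat]⟩

theorem pd_entry (a : Fin m × Fin n) (i : Fin m) (j : Fin n) (x : Matrix (Fin m) (Fin n) ℂ) :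
    pd a (fun y => y i j) x = if a = (i, j) then 1 else 0 := by
  rw [pd, (hasDerivAt_line x _ i j).deriv, Matrix.single_apply]
  exact if_congr (by rw [Prod.ext_iff]) rfl rfl

end Calculus

/-! ## Bivectors on a vector space of matrices -/

theorem update_pair_zero {M : Type*} (u v z : M) : Function.update ![u, v] 0 z = ![z, v] := by
  funext i
  fin_cases i <;> rfl

theorem update_pair_one {M : Type*} (u v z : M) : Function.update ![u, v] 1 z = ![u, z] := by
  funext i
  fin_cases i <;> rfl

section Wedge

variable {M N : Type*} [AddCommGroup M] [Module ℂ M] [AddCommGroup N] [Module ℂ N]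

/-- The wedge product as a bilinear map. -/
def wedgeₗ (M : Type*) [AddCommGroup M] [Module ℂ M] : M →ₗ[ℂ] M →ₗ[ℂ] ⋀[ℂ]^2 M :=
  LinearMap.mk₂ ℂ wedge
    (fun u u' v => by
      have := (exteriorPower.ιMulti ℂ 2).map_update_add ![u, v] 0 u u'
      simp only [update_pair_zero] at this
      exact this)
    (fun c u v => by
      have := (exteriorPower.ιMulti ℂ 2).map_update_smul ![u, v] 0 c u
      simp only [update_pair_zero] at this
      exact this)
    (fun u v v' => by
      have := (exteriorPower.ιMulti ℂ 2).map_update_add ![u, v] 1 v v'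
      simp only [update_pair_one] at this
      exact this)
    (fun c u v => by
      have := (exteriorPower.ιMulti ℂ 2).map_update_smul ![u, v] 1 c v
      simp only [update_pair_one] at this
      exact this)

theorem wedgeₗ_apply (u v : M) : wedgeₗ M u v = wedge u v := rfl

theorem wedge_self (u : M) : wedge u u = 0 :=
  (exteriorPower.ιMulti ℂ 2).map_eq_zero_of_eq ![u, u] (i := 0) (j := 1) rfl (by decide)

theorem wedge_swap (u v : M) : wedge u v = -wedge v u := by
  have h := wedge_self (u + v)
  rw [← wedgeₗ_apply] at h
  simp only [map_add, LinearMap.add_apply, wedgeₗ_apply, wedge_self, zero_add, add_zero] at h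
  exact eq_neg_of_add_eq_zero_right (add_comm (wedge u v) _ ▸ h)

theorem wedge_neg_left (u v : M) : wedge (-u) v = -wedge u v := by
  rw [← wedgeₗ_apply, map_neg, LinearMap.neg_apply, wedgeₗ_apply]

theorem wedge_neg_right (u v : M) : wedge u (-v) = -wedge u v := by
  rw [← wedgeₗ_apply, map_neg, wedgeₗ_apply]

theorem map_wedge (φ : M →ₗ[ℂ] N) (u v : M) :
    exteriorPower.map 2 φ (wedge u v) = wedge (φ u) (φ v) := by
  rw [wedge, exteriorPower.map_apply_ιMulti, wedge]
  congr 1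
  funext i
  fin_cases i <;> rfl

theorem wedge_sum_smul {ι κ : Type*} [Fintype ι] [Fintype κ] (a : ι → ℂ) (u : ι → M)
    (b : κ → ℂ) (v : κ → M) : wedge (∑ i, a i • u i) (∑ j, b j • v j) =
      ∑ i, ∑ j, (a i * b j) • wedge (u i) (v j) := by
  rw [← wedgeₗ_apply]
  simp only [map_sum, map_smul, LinearMap.sum_apply, LinearMap.smul_apply, Finset.smul_sum,
    smul_smul, wedgeₗ_apply]
  rw [Finset.sum_comm]
  simp only [mul_comm]

theorem map_rMatrix {k : ℕ} (φ : Matrix (Fin k) (Fin k) ℂ →ₗ[ℂ] M) :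
    exteriorPower.map 2 φ (rMatrix k) = ∑ i : Fin k, ∑ j : Fin k,
      if i < j then wedge (φ (Matrix.single i j 1)) (φ (Matrix.single j i 1)) else 0 := by
  simp only [rMatrix, map_sum, apply_ite (exteriorPower.map 2 φ), map_wedge, map_zero]

end Wedge

/-! ### Signs -/

/-- The sign of `j - i`. -/
def sgn {k : ℕ} (i j : Fin k) : ℤ := (SignType.sign ((j : ℤ) - (i : ℤ)) : ℤ)

theorem sgn_self {k : ℕ} (i : Fin k) : sgn i i = 0 := by simp [sgn]

theorem sgn_of_eq {k : ℕ} {i j : Fin k} (h : i = j) : sgn i j = 0 := by simp [sgn, h]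

theorem sgn_of_lt {k : ℕ} {i j : Fin k} (h : i < j) : sgn i j = 1 := by
  have : (0 : ℤ) < (j : ℤ) - (i : ℤ) := by
    have : (i : ℕ) < j := h
    omega
  rw [sgn, sign_pos this]; rfl

theorem sgn_of_gt {k : ℕ} {i j : Fin k} (h : j < i) : sgn i j = -1 := by
  have : (j : ℤ) - (i : ℤ) < 0 := by
    have : (j : ℕ) < i := h
    omega
  rw [sgn, sign_neg this]; rfl

theorem sgn_swap {k : ℕ} (i j : Fin k) : sgn i j = -sgn j i := by
  rcases lt_trichotomy i j with h | rfl | h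
  · rw [sgn_of_lt h, sgn_of_gt h]; rfl
  · simp [sgn_self]
  · rw [sgn_of_lt h, sgn_of_gt h]

theorem sgn_eq_ite {k : ℕ} (i j : Fin k) :
    (sgn i j : ℂ) = (if i < j then 1 else 0) - (if j < i then 1 else 0) := by
  rcases lt_trichotomy i j with h | rfl | h
  · simp [sgn_of_lt h, h, h.not_gt]
  · simp [sgn_self]
  · simp [sgn_of_gt h, h, h.not_gt]

/-- The classical Yang-Baxter identity for the signs. -/
theorem sgn_yang_baxter {k : ℕ} (i j l : Fin k) :
    (i = j ∧ j = l) ∨ sgn i j * sgn j l + sgn j l * sgn l i + sgn l i * sgn i j = -1 := by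
  rcases lt_trichotomy i j with h1 | h1 | h1 <;> rcases lt_trichotomy j l with h2 | h2 | h2 <;>
    rcases lt_trichotomy l i with h3 | h3 | h3 <;>
    first
    | (exfalso; omega)
    | (left; exact ⟨h1, h2⟩)
    | (right
       (first | rw [sgn_of_lt h1] | rw [sgn_of_eq h1] | rw [sgn_of_gt h1])
       (first | rw [sgn_of_lt h2] | rw [sgn_of_eq h2] | rw [sgn_of_gt h2])
       (first | rw [sgn_of_lt h3] | rw [sgn_of_eq h3] | rw [sgn_of_gt h3])
       rfl)

theorem sum_sum_eq_zero_of_antisymm {ι V : Type*} [Fintype ι] [AddCommGroup V] [Module ℂ V]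
    {T : ι → ι → V} (hT : ∀ a b, T a b = -T b a) : ∑ a, ∑ b, T a b = 0 := by
  have h : ∑ a, ∑ b, T a b = -∑ a, ∑ b, T a b := by
    conv_lhs => rw [Finset.sum_comm]
    simp only [← Finset.sum_neg_distrib]
    exact Finset.sum_congr rfl fun a _ => Finset.sum_congr rfl fun b _ => hT b a
  have h2 : (2 : ℂ) • ∑ a, ∑ b, T a b = 0 := by
    rw [two_smul]
    exact eq_neg_iff_add_eq_zero.1 h
  exact (smul_eq_zero.1 h2).resolve_left two_ne_zero

/-- Passes between signed sums over all pairs, as in the coordinate formula, and sums over ordered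
pairs, as in the $r$-matrix. The terms `(a, b)` and `(b, a)` agree once signs are included; the
factor 2 cancels the one half of the formula. -/
theorem sum_sgn_smul_of_antisymm {ι V : Type*} [Fintype ι] [AddCommGroup V] [Module ℂ V]
    {T : ι → ι → V} (hT : ∀ a b, T a b = -T b a) {k : ℕ} (p : ι → Fin k) :
    ∑ a, ∑ b, (sgn (p a) (p b) : ℂ) • T a b =
      (2 : ℂ) • ∑ a, ∑ b, if p a < p b then T a b else 0 := by
  have h : ∑ a, ∑ b, (if p b < p a then T a b else 0) =
      -∑ a, ∑ b, if p a < p b then T a b else 0 := by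
    rw [Finset.sum_comm]
    simp only [← Finset.sum_neg_distrib]
    refine Finset.sum_congr rfl fun a _ => Finset.sum_congr rfl fun b _ => ?_
    rw [hT b a]
    split_ifs <;> simp
  simp only [sgn_eq_ite, sub_smul, ite_smul, one_smul, zero_smul, Finset.sum_sub_distrib, h]
  rw [sub_neg_eq_add, two_smul]

/-! ### The quadratic bivector in coordinates -/

section Coordinates

variable {m n : ℕ} (x : Matrix (Fin m) (Fin n) ℂ)

theorem sum_pairs {A : Type*} [AddCommMonoid A] (F : Fin m → Fin m → Fin n → Fin n → A) :
    ∑ i, ∑ k, ∑ j, ∑ l, F i k j l =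
      ∑ a : Fin m × Fin n, ∑ b : Fin m × Fin n, F a.1 b.1 a.2 b.2 := by
  simp only [Fintype.sum_prod_type]
  exact Finset.sum_congr rfl fun i _ => Finset.sum_comm

/-- The bivector `x_{il} x_{kj} e_{ij} ∧ e_{kl}`. -/
def exchange (a b : Fin m × Fin n) : ⋀[ℂ]^2 (Matrix (Fin m) (Fin n) ℂ) :=
  (x a.1 b.2 * x b.1 a.2) • wedge (Matrix.single a.1 a.2 (1 : ℂ)) (Matrix.single b.1 b.2 (1 : ℂ))

theorem exchange_swap (a b : Fin m × Fin n) : exchange x a b = -exchange x b a := by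
  rw [exchange, wedge_swap, smul_neg, exchange, mul_comm]

/-- Left multiplication of `x`. -/
def mulLeftOf (k : ℕ) (x : Matrix (Fin m) (Fin n) ℂ) :
    Matrix (Fin k) (Fin m) ℂ →ₗ[ℂ] Matrix (Fin k) (Fin n) ℂ where
  toFun a := a * x
  map_add' a b := Matrix.add_mul a b _
  map_smul' c a := Matrix.smul_mul c a _

/-- Right multiplication of `x`. -/
def mulRightOf (k : ℕ) (x : Matrix (Fin m) (Fin n) ℂ) :
    Matrix (Fin n) (Fin k) ℂ →ₗ[ℂ] Matrix (Fin m) (Fin k) ℂ where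
  toFun a := x * a
  map_add' a b := Matrix.mul_add _ a b
  map_smul' c a := Matrix.mul_smul _ c a

theorem single_mul_eq_sum {k : ℕ} (i : Fin k) (j : Fin m) :
    Matrix.single i j (1 : ℂ) * x = ∑ l, x j l • Matrix.single i l (1 : ℂ) := by
  ext p q
  simp only [Matrix.sum_apply, Matrix.smul_apply, Matrix.single_apply, Matrix.mul_apply, smul_eq_mul,
    ite_and, mul_ite, mul_one, mul_zero, ite_mul, one_mul, zero_mul]
  by_cases h : i = p <;> simp [h]

theorem mul_single_eq_sum {k : ℕ} (i : Fin n) (j : Fin k) :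
    x * Matrix.single i j (1 : ℂ) = ∑ l, x l i • Matrix.single l j (1 : ℂ) := by
  ext p q
  simp only [Matrix.sum_apply, Matrix.smul_apply, Matrix.single_apply, Matrix.mul_apply, smul_eq_mul,
    ite_and, mul_ite, mul_one, mul_zero]
  by_cases h : j = q <;> simp [h]

/-- Since $E_{ik}x=\sum_l x_{kl}e_{il}$, the factors of $E_{ik}x\wedge E_{ki}x$ stay in rows $i$ and
$k$, and the order of the rows is kept. -/
theorem map_mulLeftOf_rMatrix : exteriorPower.map 2 (mulLeftOf m x) (rMatrix m) =
    ∑ a : Fin m × Fin n, ∑ b : Fin m × Fin n, if a.1 < b.1 then exchange x a b else 0 := by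
  rw [map_rMatrix, ← sum_pairs (fun i k j l => if i < k then exchange x (i, j) (k, l) else 0)]
  refine Finset.sum_congr rfl fun i _ => Finset.sum_congr rfl fun k _ => ?_
  split_ifs with h
  · change wedge (Matrix.single i k (1 : ℂ) * x) (Matrix.single k i (1 : ℂ) * x) = _
    rw [single_mul_eq_sum, single_mul_eq_sum, wedge_sum_smul]
    refine Finset.sum_congr rfl fun j _ => Finset.sum_congr rfl fun l _ => ?_
    rw [exchange, mul_comm]
  · simp

/-- Since $xE_{jl}=\sum_k x_{kj}e_{kl}$, the first factor of $xE_{jl}\wedge xE_{lj}$ lies in column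
$l$ and the second in column $j$. Restoring the order of the columns costs the minus sign. -/
theorem map_mulRightOf_rMatrix : exteriorPower.map 2 (mulRightOf n x) (rMatrix n) =
    -∑ a : Fin m × Fin n, ∑ b : Fin m × Fin n, if a.2 < b.2 then exchange x a b else 0 := by
  rw [map_rMatrix, ← sum_pairs (fun i k j l => if j < l then exchange x (i, j) (k, l) else 0)]
  have e : (∑ i : Fin m, ∑ k : Fin m, ∑ j : Fin n, ∑ l : Fin n,
      if j < l then exchange x (i, j) (k, l) else 0) =
      ∑ j : Fin n, ∑ l : Fin n, ∑ k : Fin m, ∑ i : Fin m,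
        if j < l then exchange x (i, j) (k, l) else 0 := by
    simp only [← Fintype.sum_prod_type']
    exact Fintype.sum_equiv (Equiv.mk (fun p => (p.2.2.1, p.2.2.2, p.2.1, p.1))
      (fun p => (p.2.2.2, p.2.2.1, p.1, p.2.1)) (fun _ => rfl) (fun _ => rfl)) _ _ (fun _ => rfl)
  rw [e, ← Finset.sum_neg_distrib]
  refine Finset.sum_congr rfl fun j _ => ?_
  rw [← Finset.sum_neg_distrib]
  refine Finset.sum_congr rfl fun l _ => ?_
  split_ifs with h
  · change wedge (x * Matrix.single j l (1 : ℂ)) (x * Matrix.single l j (1 : ℂ)) = _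
    rw [mul_single_eq_sum, mul_single_eq_sum, wedge_sum_smul, ← Finset.sum_neg_distrib]
    refine Finset.sum_congr rfl fun k _ => ?_
    rw [← Finset.sum_neg_distrib]
    refine Finset.sum_congr rfl fun i _ => ?_
    rw [← exchange_swap, exchange]
  · simp

end Coordinates

/-! ### The `r`-matrix in the big cell of the Grassmannian -/

section BigCell

variable {m n : ℕ}

theorem longest_mul_self (n : ℕ) : longest n * longest n = 1 := by
  ext i j
  simp only [longest, Matrix.mul_apply, Matrix.of_apply, mul_ite, mul_one, mul_zero]
  rw [Finset.sum_eq_single (Fin.rev j) (fun b _ hb => if_neg hb) (by simp)]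
  simp [Matrix.one_apply]

theorem longest_mul_single {k : ℕ} (i : Fin n) (j : Fin k) :
    longest n * Matrix.single i j (1 : ℂ) = Matrix.single (Fin.rev i) j 1 := by
  ext p q
  rw [mul_single_eq_sum]
  simp only [longest, Matrix.sum_apply, Matrix.smul_apply, Matrix.single_apply, Matrix.of_apply,
    smul_eq_mul, ite_mul, one_mul, zero_mul, Finset.sum_ite_eq', Finset.mem_univ, if_true]

theorem single_mul_longest {k : ℕ} (i : Fin k) (j : Fin n) :
    Matrix.single i j (1 : ℂ) * longest n = Matrix.single i (Fin.rev j) 1 := by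
  ext p q
  rw [single_mul_eq_sum]
  have h : ∀ l : Fin n, j = Fin.rev l ↔ Fin.rev j = l := fun l => by
    rw [eq_comm, Fin.rev_eq_iff, eq_comm]
  simp only [longest, Matrix.sum_apply, Matrix.smul_apply, Matrix.single_apply, Matrix.of_apply,
    smul_eq_mul, ite_mul, one_mul, zero_mul, h, Finset.sum_ite_eq, Finset.mem_univ, if_true]

/-- The infinitesimal action of `gl_{n+m}` in the coordinate `x` on the big cell. -/
def cellVelocity (x : Matrix (Fin m) (Fin n) ℂ) :
    Matrix (Fin (n + m)) (Fin (n + m)) ℂ →ₗ[ℂ] Matrix (Fin m) (Fin n) ℂ where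
  -- With $y=xw_\circ$, the block matrix $\left[\begin{smallmatrix}A&B\\C&D\end{smallmatrix}\right]$
  -- acts by $y\mapsto(C+Dy)(A+By)^{-1}$. Its derivative at the identity is $c+dy-ya-yby$; multiply
  -- on the right by $w_\circ$ and use $w_\circ^2=1$.
  toFun a := a.submatrix (Fin.natAdd n) (Fin.castAdd m) * longest n
    + a.submatrix (Fin.natAdd n) (Fin.natAdd n) * x
    - x * (longest n * a.submatrix (Fin.castAdd m) (Fin.castAdd m) * longest n)
    - x * (longest n * a.submatrix (Fin.castAdd m) (Fin.natAdd n)) * x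
  map_add' a b := by
    simp only [Matrix.submatrix_add, Pi.add_apply, Matrix.add_mul, Matrix.mul_add]
    abel
  map_smul' c a := by
    simp only [Matrix.submatrix_smul, Pi.smul_apply, Matrix.smul_mul, Matrix.mul_smul,
      RingHom.id_apply, smul_sub, smul_add]

theorem submatrix_single_of_injective {k l p q : ℕ} {f : Fin k → Fin p} {g : Fin l → Fin q}
    (hf : Function.Injective f) (hg : Function.Injective g) (i : Fin k) (j : Fin l) :
    (Matrix.single (f i) (g j) (1 : ℂ)).submatrix f g = Matrix.single i j 1 := by
  ext a b
  simp [Matrix.single_apply, hf.eq_iff, hg.eq_iff]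

theorem submatrix_single_of_left {k l p q : ℕ} {f : Fin k → Fin p} {i : Fin p}
    (hi : ∀ a, i ≠ f a) (g : Fin l → Fin q) (j : Fin q) :
    (Matrix.single i j (1 : ℂ)).submatrix f g = 0 := by
  ext a b
  simp [hi]

theorem submatrix_single_of_right {k l p q : ℕ} {g : Fin l → Fin q} {j : Fin q}
    (hj : ∀ a, j ≠ g a) (f : Fin k → Fin p) (i : Fin p) :
    (Matrix.single i j (1 : ℂ)).submatrix f g = 0 := by
  ext a b
  simp [hj]

theorem castAdd_ne_natAdd (i : Fin n) (j : Fin m) : Fin.castAdd m i ≠ Fin.natAdd n j := fun h => by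
  have := congrArg Fin.val h
  rw [Fin.val_castAdd, Fin.val_natAdd] at this
  omega

theorem cellVelocity_apply (x : Matrix (Fin m) (Fin n) ℂ)
    (a : Matrix (Fin (n + m)) (Fin (n + m)) ℂ) : cellVelocity x a =
      a.submatrix (Fin.natAdd n) (Fin.castAdd m) * longest n
        + a.submatrix (Fin.natAdd n) (Fin.natAdd n) * x
        - x * (longest n * a.submatrix (Fin.castAdd m) (Fin.castAdd m) * longest n)
        - x * (longest n * a.submatrix (Fin.castAdd m) (Fin.natAdd n)) * x := rfl

theorem cellVelocity_castAdd_castAdd (x : Matrix (Fin m) (Fin n) ℂ) (i j : Fin n) :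
    cellVelocity x (Matrix.single (Fin.castAdd m i) (Fin.castAdd m j) 1) =
      -(x * Matrix.single (Fin.rev i) (Fin.rev j) (1 : ℂ)) := by
  rw [cellVelocity_apply, submatrix_single_of_left (castAdd_ne_natAdd i),
    submatrix_single_of_left (castAdd_ne_natAdd i), submatrix_single_of_injective
      (Fin.castAdd_injective n m) (Fin.castAdd_injective n m),
    submatrix_single_of_right (castAdd_ne_natAdd j), longest_mul_single, single_mul_longest]
  simp

theorem cellVelocity_natAdd_natAdd (x : Matrix (Fin m) (Fin n) ℂ) (i j : Fin m) :
    cellVelocity x (Matrix.single (Fin.natAdd n i) (Fin.natAdd n j) 1) =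
      Matrix.single i j (1 : ℂ) * x := by
  rw [cellVelocity_apply, submatrix_single_of_left fun a => (castAdd_ne_natAdd a i).symm,
    submatrix_single_of_left fun a => (castAdd_ne_natAdd a i).symm, submatrix_single_of_injective
      (Fin.natAdd_injective m n) (Fin.natAdd_injective m n),
    submatrix_single_of_right fun a => (castAdd_ne_natAdd a j).symm]
  simp

theorem cellVelocity_castAdd_natAdd (x : Matrix (Fin m) (Fin n) ℂ) (i : Fin n) (j : Fin m) :
    cellVelocity x (Matrix.single (Fin.castAdd m i) (Fin.natAdd n j) 1) =
      -(x * Matrix.single (Fin.rev i) j (1 : ℂ) * x) := by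
  rw [cellVelocity_apply, submatrix_single_of_left (castAdd_ne_natAdd i),
    submatrix_single_of_left (castAdd_ne_natAdd i), submatrix_single_of_injective
      (Fin.castAdd_injective n m) (Fin.natAdd_injective m n),
    submatrix_single_of_right fun a => (castAdd_ne_natAdd a j).symm, longest_mul_single]
  simp

theorem cellVelocity_natAdd_castAdd (x : Matrix (Fin m) (Fin n) ℂ) (i : Fin m) (j : Fin n) :
    cellVelocity x (Matrix.single (Fin.natAdd n i) (Fin.castAdd m j) 1) =
      Matrix.single i (Fin.rev j) (1 : ℂ) := by
  rw [cellVelocity_apply, submatrix_single_of_left fun a => (castAdd_ne_natAdd a i).symm,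
    submatrix_single_of_left fun a => (castAdd_ne_natAdd a i).symm, submatrix_single_of_injective
      (Fin.natAdd_injective m n) (Fin.castAdd_injective n m),
    submatrix_single_of_right (castAdd_ne_natAdd j), single_mul_longest]
  simp

/-- The computation behind the comparison of the two bivector fields: the pairs $i<j$ in $r^N$ are
sorted according to the blocks that contain $i$ and $j$. -/
theorem map_cellVelocity_rMatrix (x : Matrix (Fin m) (Fin n) ℂ) :
    -exteriorPower.map 2 (cellVelocity x) (rMatrix (n + m)) =
      exteriorPower.map 2 (mulRightOf n x) (rMatrix n)
        - exteriorPower.map 2 (mulLeftOf m x) (rMatrix m) := by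
  have hcc : ∀ i j : Fin n, Fin.castAdd m i < Fin.castAdd m j ↔ i < j := fun i j => Iff.rfl
  have hnn : ∀ i j : Fin m, Fin.natAdd n i < Fin.natAdd n j ↔ i < j := fun i j => by
    simp
  have hcn : ∀ (i : Fin n) (j : Fin m), Fin.castAdd m i < Fin.natAdd n j := fun i j => by
    rw [Fin.lt_def, Fin.val_castAdd, Fin.val_natAdd]; omega
  have hnc : ∀ (i : Fin m) (j : Fin n), ¬ Fin.natAdd n i < Fin.castAdd m j := fun i j =>
    (hcn j i).not_gt
  -- Conjugation by $w_\circ$ reverses the order of the indices, which turns $r^n$ into $-r^n$.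
  have hA : (∑ i : Fin n, ∑ j : Fin n, if i < j then
      wedge (x * Matrix.single (Fin.rev i) (Fin.rev j) (1 : ℂ))
        (x * Matrix.single (Fin.rev j) (Fin.rev i) (1 : ℂ)) else 0) =
      -exteriorPower.map 2 (mulRightOf n x) (rMatrix n) := by
    rw [map_rMatrix, ← Finset.sum_neg_distrib, Finset.sum_comm]
    refine Fintype.sum_equiv Fin.revPerm _ _ fun i => ?_
    rw [← Finset.sum_neg_distrib]
    refine Fintype.sum_equiv Fin.revPerm _ _ fun j => ?_
    simp only [Fin.revPerm_apply, Fin.rev_lt_rev]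
    split_ifs
    · exact wedge_swap _ _
    · simp
  -- The mixed pairs give the sum of `exchange x a b` over all `a` and `b`, with no condition on
  -- their order, and this vanishes by antisymmetry.
  have hB : (∑ i : Fin n, ∑ k : Fin m, wedge (x * Matrix.single (Fin.rev i) k (1 : ℂ) * x)
      (Matrix.single k (Fin.rev i) (1 : ℂ))) = 0 := by
    rw [← sum_sum_eq_zero_of_antisymm (exchange_swap x), Finset.sum_comm]
    conv_rhs => rw [Finset.sum_comm]
    rw [Fintype.sum_prod_type]
    refine Finset.sum_congr rfl fun k _ => Fintype.sum_equiv Fin.revPerm _ _ fun i => ?_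
    have e : x * Matrix.single (Fin.rev i) k (1 : ℂ) * x =
        ∑ a : Fin m × Fin n, (x a.1 (Fin.rev i) * x k a.2) • Matrix.single a.1 a.2 (1 : ℂ) := by
      rw [mul_single_eq_sum, Matrix.sum_mul, Fintype.sum_prod_type]
      refine Finset.sum_congr rfl fun a _ => ?_
      rw [Matrix.smul_mul, single_mul_eq_sum, Finset.smul_sum]
      simp only [smul_smul]
    rw [e, ← wedgeₗ_apply, map_sum, LinearMap.sum_apply]
    refine Finset.sum_congr rfl fun a _ => ?_
    rw [map_smul, LinearMap.smul_apply, wedgeₗ_apply, exchange]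
    rfl
  have hD : (∑ i : Fin m, ∑ j : Fin m, if i < j then
      wedge (Matrix.single i j (1 : ℂ) * x) (Matrix.single j i (1 : ℂ) * x) else 0) =
      exteriorPower.map 2 (mulLeftOf m x) (rMatrix m) := by
    rw [map_rMatrix]
    rfl
  rw [map_rMatrix]
  simp only [Fin.sum_univ_add, hcc, hnn, hcn, hnc, if_true, if_false, cellVelocity_castAdd_castAdd,
    cellVelocity_natAdd_natAdd, cellVelocity_castAdd_natAdd, cellVelocity_natAdd_castAdd,
    wedge_neg_left, wedge_neg_right, neg_neg, Finset.sum_neg_distrib, Finset.sum_add_distrib, hA, hB, hD,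
    Finset.sum_const_zero]
  abel

end BigCell

/-! ## The standard Poisson structure on the variety of matrices -/

section MatPoisson

variable {m n : ℕ}

/-- The curves $\exp(ta)x$ and $x+tax$ have the same velocity at $t=0$, and derivatives of regular
functions depend only on the velocity. -/
theorem leftAction_chi (x : Matrix (Fin m) (Fin n) ℂ) :
    (leftAction m n).chi x = velocity x ∘ₗ mulLeftOf m x := by
  refine LinearMap.ext fun a => tangent_ext fun f => ?_
  obtain ⟨L, hL⟩ := matSpace_hasDerivAt f.2
  have h1 := hL (fun t => (expGL (t • a)).1 * x) (a * x)
    (by simp only [expGL_zero_smul]; exact Matrix.one_mul _) (expGL_mul_hasDerivAt a x)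
  have h2 := hL (fun t => x + t • (a * x)) (a * x) (by simp) (hasDerivAt_line x _)
  exact h1.deriv.trans h2.deriv.symm

theorem rightAction_chi (x : Matrix (Fin m) (Fin n) ℂ) :
    (rightAction m n).chi x = -(velocity x ∘ₗ mulRightOf n x) := by
  refine LinearMap.ext fun a => tangent_ext fun f => ?_
  obtain ⟨L, hL⟩ := matSpace_hasDerivAt f.2
  have h1 := hL (fun t : ℂ => x * ((expGL (t • a))⁻¹).1) (-(x * a))
    (by simp only [expGL_zero_smul]; simp) (fun i j => by
      have e : ∀ t : ℂ, ((expGL (t • a))⁻¹).1 = (expGL (t • (-a))).1 := by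
        intro t
        change NormedSpace.exp (-(t • a)) = NormedSpace.exp (t • (-a))
        rw [smul_neg]
      rw [← Matrix.mul_neg]
      simp only [e, Matrix.mul_apply]
      exact HasDerivAt.fun_sum fun s _ => (expGL_hasDerivAt (-a) s j).const_mul _)
  have h2 := hL (fun t => x + t • (x * a)) (x * a) (by simp) (hasDerivAt_line x _)
  refine h1.deriv.trans ?_
  rw [map_neg]
  exact congrArg Neg.neg h2.deriv.symm

/-- Removes the sign that comes from the inverse in the action $g.x=xg^{-1}$. -/
theorem map_neg_two {M N : Type*} [AddCommGroup M] [Module ℂ M] [AddCommGroup N] [Module ℂ N]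
    (φ : M →ₗ[ℂ] N) : exteriorPower.map 2 (-φ) = exteriorPower.map 2 φ := by
  apply exteriorPower.linearMap_ext
  ext v
  have hv : v = ![v 0, v 1] := by
    funext i
    fin_cases i <;> rfl
  have key : exteriorPower.map 2 (-φ) (wedge (v 0) (v 1)) =
      exteriorPower.map 2 φ (wedge (v 0) (v 1)) := by
    rw [map_wedge, map_wedge, LinearMap.neg_apply, LinearMap.neg_apply, wedge_neg_left,
      wedge_neg_right, neg_neg]
  rw [hv]
  exact congrArg Subtype.val key

theorem matPoisson_eq_map (x : Matrix (Fin m) (Fin n) ℂ) : matPoisson m n x =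
    exteriorPower.map 2 (velocity x) (exteriorPower.map 2 (mulRightOf n x) (rMatrix n)
      - exteriorPower.map 2 (mulLeftOf m x) (rMatrix m)) := by
  have hL : (leftAction m n).chi₂ (rMatrix m) x =
      exteriorPower.map 2 (velocity x) (exteriorPower.map 2 (mulLeftOf m x) (rMatrix m)) := by
    rw [HasInfAction.chi₂, leftAction_chi, exteriorPower.map_comp]
    rfl
  have hR : (rightAction m n).chi₂ (rMatrix n) x =
      exteriorPower.map 2 (velocity x) (exteriorPower.map 2 (mulRightOf n x) (rMatrix n)) := by
    rw [HasInfAction.chi₂, rightAction_chi, map_neg_two, exteriorPower.map_comp]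
    rfl
  exact (congrArg₂ (· - ·) hR hL).trans (map_sub _ _ _).symm

/-- The coefficients of the bracket: `{x_a, x_b} = coeff x a b`. -/
def coeff (x : Matrix (Fin m) (Fin n) ℂ) (a b : Fin m × Fin n) : ℂ :=
  -((sgn a.1 b.1 : ℂ) + (sgn a.2 b.2 : ℂ)) * (x a.1 b.2 * x b.1 a.2)

theorem coeff_swap (x : Matrix (Fin m) (Fin n) ℂ) (a b : Fin m × Fin n) :
    coeff x a b = -coeff x b a := by
  rw [coeff, coeff, sgn_swap a.1, sgn_swap a.2]
  push_cast
  ring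

theorem matPoissonCoord_eq_sum (x : Matrix (Fin m) (Fin n) ℂ) : matPoissonCoord m n x =
    ∑ a : Fin m × Fin n, ∑ b : Fin m × Fin n,
      (1 / 2 * coeff x a b) • wedge (partialAt a.1 a.2 x) (partialAt b.1 b.2 x) := by
  rw [matPoissonCoord, sum_pairs (fun i k j l =>
    (((SignType.sign ((k : ℤ) - (i : ℤ)) : ℤ) + (SignType.sign ((l : ℤ) - (j : ℤ)) : ℤ) : ℤ) : ℂ)
      • (x i l * x k j) • wedge (partialAt i j x) (partialAt k l x)), Finset.smul_sum]
  refine Finset.sum_congr rfl fun a _ => ?_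
  rw [Finset.smul_sum]
  refine Finset.sum_congr rfl fun b _ => ?_
  rw [smul_smul, smul_smul]
  congr 1
  rw [coeff, Int.cast_add]
  change -(1 / 2) * ((sgn a.1 b.1 : ℂ) + (sgn a.2 b.2 : ℂ)) * _ = _
  ring

theorem matPoisson_eq_coord (x : Matrix (Fin m) (Fin n) ℂ) :
    matPoisson m n x = matPoissonCoord m n x := by
  have h : exteriorPower.map 2 (mulRightOf n x) (rMatrix n)
      - exteriorPower.map 2 (mulLeftOf m x) (rMatrix m) = ∑ a : Fin m × Fin n, ∑ b : Fin m × Fin n,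
        (1 / 2 * coeff x a b) • wedge (Matrix.single a.1 a.2 (1 : ℂ))
          (Matrix.single b.1 b.2 (1 : ℂ)) := by
    have e : ∀ a b : Fin m × Fin n, (1 / 2 * coeff x a b) •
        wedge (Matrix.single a.1 a.2 (1 : ℂ)) (Matrix.single b.1 b.2 (1 : ℂ)) =
        (-(1 / 2) : ℂ) • ((sgn a.1 b.1 : ℂ) • exchange x a b +
          (sgn a.2 b.2 : ℂ) • exchange x a b) := fun a b => by
      rw [exchange, smul_smul, smul_smul, ← add_smul, smul_smul, coeff]
      congr 1
      ring
    simp only [e, ← Finset.smul_sum, Finset.sum_add_distrib]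
    rw [sum_sgn_smul_of_antisymm (exchange_swap x) Prod.fst,
      sum_sgn_smul_of_antisymm (exchange_swap x) Prod.snd,
      map_mulLeftOf_rMatrix, map_mulRightOf_rMatrix, ← smul_add, smul_smul]
    norm_num
    abel
  rw [matPoisson_eq_map, h, matPoissonCoord_eq_sum]
  simp only [map_sum, map_smul, map_wedge]
  rfl

/-! ### The quadratic bracket of regular functions. -/

theorem bracket_matPoisson {f g : Matrix (Fin m) (Fin n) ℂ → ℂ} {x : Matrix (Fin m) (Fin n) ℂ}
    (hf : (matSpace m n).Reg f x) (hg : (matSpace m n).Reg g x) :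
    (matSpace m n).bracket (matPoisson m n) f g x =
      ∑ a, ∑ b, coeff x a b * pd a f x * pd b g x := by
  refine (bracket_eq _ hf hg).trans ((congrArg _
    ((matPoisson_eq_coord x).trans (matPoissonCoord_eq_sum x))).trans ?_)
  have e : ∀ a b : Fin m × Fin n, exteriorPower.pairingDual ℂ ((matSpace m n).Tangent x) 2
      (wedge ((matSpace m n).dfun x ⟨f, hf⟩) ((matSpace m n).dfun x ⟨g, hg⟩))
      (wedge (partialAt a.1 a.2 x) (partialAt b.1 b.2 x)) =
      pd a f x * pd b g x - pd a g x * pd b f x := fun a b => pairing_wedge_wedge _ _ _ _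
  simp only [map_sum, map_smul, e, smul_eq_mul]
  have h1 : ∑ a, ∑ b, coeff x a b * pd a f x * pd b g x =
      ∑ a, ∑ b, (1 / 2 * coeff x a b * (pd a f x * pd b g x)
        + 1 / 2 * coeff x a b * (pd a f x * pd b g x)) :=
    Finset.sum_congr rfl fun a _ => Finset.sum_congr rfl fun b _ => by ring
  -- Both terms of the pairing contribute equally because `coeff` is antisymmetric, which absorbs
  -- the factor one half.
  have h2 : ∑ a, ∑ b, 1 / 2 * coeff x a b * (pd a g x * pd b f x) =
      -∑ a, ∑ b, 1 / 2 * coeff x a b * (pd a f x * pd b g x) := by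
    rw [Finset.sum_comm]
    simp only [← Finset.sum_neg_distrib]
    refine Finset.sum_congr rfl fun a _ => Finset.sum_congr rfl fun b _ => ?_
    rw [coeff_swap x b a]; ring
  rw [h1]
  simp only [mul_sub, Finset.sum_sub_distrib, Finset.sum_add_distrib, h2]
  ring

theorem reg_fun_sum {X : FnSpace} {x : X.carrier} {κ : Type*} (s : Finset κ)
    {f : κ → X.carrier → ℂ} (hf : ∀ k, X.Reg (f k) x) : X.Reg (fun y => ∑ k ∈ s, f k y) x := by
  have := (X.regAlg x).sum_mem (t := s) fun k _ => (regAlg_coe.2 (hf k))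
  rw [regAlg_coe] at this
  convert this using 1
  funext y
  simp

theorem reg_coeff (a b : Fin m × Fin n) (x : Matrix (Fin m) (Fin n) ℂ) :
    (matSpace m n).Reg (fun y => coeff y a b) x :=
  (matSpace m n).reg_mul ((matSpace m n).reg_const _ x)
    ((matSpace m n).reg_mul (reg_entry _ _ x) (reg_entry _ _ x))

theorem reg_bracket_term {f g : Matrix (Fin m) (Fin n) ℂ → ℂ} {x : Matrix (Fin m) (Fin n) ℂ}
    (hf : (matSpace m n).Reg f x) (hg : (matSpace m n).Reg g x) (a b : Fin m × Fin n) :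
    (matSpace m n).Reg (fun y => coeff y a b * pd a f y * pd b g y) x :=
  (matSpace m n).reg_mul ((matSpace m n).reg_mul (reg_coeff a b x) (reg_pd a hf)) (reg_pd b hg)

/-- The formula is needed on a neighbourhood, not only at `x`, since an outer bracket differentiates
the inner one. -/
theorem reg_bracket_matPoisson {f g : Matrix (Fin m) (Fin n) ℂ → ℂ}
    {x : Matrix (Fin m) (Fin n) ℂ} (hf : (matSpace m n).Reg f x) (hg : (matSpace m n).Reg g x) :
    (∀ᶠ y in @nhds _ (zariski m n) x, (matSpace m n).bracket (matPoisson m n) f g y =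
      ∑ a, ∑ b, coeff y a b * pd a f y * pd b g y) ∧
    (matSpace m n).Reg ((matSpace m n).bracket (matPoisson m n) f g) x := by
  have h1 : ∀ᶠ y in @nhds _ (zariski m n) x, (matSpace m n).bracket (matPoisson m n) f g y =
      ∑ a, ∑ b, coeff y a b * pd a f y * pd b g y := by
    filter_upwards [(matSpace m n).reg_nhds hf, (matSpace m n).reg_nhds hg] with y h1 h2
    exact bracket_matPoisson h1 h2
  refine ⟨h1, (matSpace m n).reg_congr (h1.mono fun y hy => hy.symm) ?_⟩
  exact reg_fun_sum _ fun a => reg_fun_sum _ fun b => reg_bracket_term hf hg a b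

/-! ### The Jacobi identity for the quadratic bracket. -/

theorem pd_coeff (d a b : Fin m × Fin n) (x : Matrix (Fin m) (Fin n) ℂ) :
    pd d (fun y => coeff y a b) x = -((sgn a.1 b.1 : ℂ) + (sgn a.2 b.2 : ℂ)) *
      ((if d = (a.1, b.2) then 1 else 0) * x b.1 a.2
        + x a.1 b.2 * (if d = (b.1, a.2) then 1 else 0)) := by
  have h := pd_mul d ((matSpace m n).reg_const (-((sgn a.1 b.1 : ℂ) + (sgn a.2 b.2 : ℂ))) x)
    ((matSpace m n).reg_mul (reg_entry a.1 b.2 x) (reg_entry b.1 a.2 x))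
  have h0 : pd d (fun _ => -((sgn a.1 b.1 : ℂ) + (sgn a.2 b.2 : ℂ))) x = 0 := deriv_const _ _
  have h2 := pd_mul d (reg_entry a.1 b.2 x) (reg_entry b.1 a.2 x)
  rw [pd_entry, pd_entry] at h2
  rw [h0, zero_mul, zero_add] at h
  exact h.trans (congrArg _ h2)

theorem sum_coeff_mul_pd_coeff (a b c : Fin m × Fin n) (x : Matrix (Fin m) (Fin n) ℂ) :
    ∑ d, coeff x a d * pd d (fun y => coeff y b c) x =
      -((sgn b.1 c.1 : ℂ) + (sgn b.2 c.2 : ℂ)) *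
        (coeff x a (b.1, c.2) * x c.1 b.2 + x b.1 c.2 * coeff x a (c.1, b.2)) := by
  have e : ∀ d, coeff x a d * pd d (fun y => coeff y b c) x =
      -((sgn b.1 c.1 : ℂ) + (sgn b.2 c.2 : ℂ)) *
      ((if d = (b.1, c.2) then coeff x a d * x c.1 b.2 else 0)
        + (if d = (c.1, b.2) then x b.1 c.2 * coeff x a d else 0)) := fun d => by
    rw [pd_coeff]
    split_ifs <;> ring
  simp only [e, ← Finset.mul_sum, Finset.sum_add_distrib, Finset.sum_ite_eq', Finset.mem_univ,
    if_true]

/-- After expansion, the products of a row sign with a column sign cancel identically. The row signs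
and the column signs enter through the same cyclic expression, with opposite signs, times a
difference of two cubic monomials. By `sgn_yang_baxter` that expression is $-1$ unless its three
indices coincide, and in that case the two monomials are equal. The two constants $-1$ cancel each
other. -/
theorem jacobi_coeff (a b c : Fin m × Fin n) (x : Matrix (Fin m) (Fin n) ℂ) :
    (∑ d, coeff x a d * pd d (fun y => coeff y b c) x)
      + (∑ d, coeff x b d * pd d (fun y => coeff y c a) x)
      + (∑ d, coeff x c d * pd d (fun y => coeff y a b) x) = 0 := by
  rw [sum_coeff_mul_pd_coeff, sum_coeff_mul_pd_coeff, sum_coeff_mul_pd_coeff]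
  obtain ⟨a1, a2⟩ := a
  obtain ⟨b1, b2⟩ := b
  obtain ⟨c1, c2⟩ := c
  simp only [coeff]
  rw [sgn_swap a1 c1, sgn_swap a2 c2, sgn_swap b1 a1, sgn_swap b2 a2, sgn_swap c1 b1,
    sgn_swap c2 b2]
  have e1 : (((sgn a1 b1 * sgn b1 c1 + sgn b1 c1 * sgn c1 a1 + sgn c1 a1 * sgn a1 b1 + 1 : ℤ) : ℂ)) *
      (x a1 c2 * x b1 a2 * x c1 b2 - x a1 b2 * x b1 c2 * x c1 a2) = 0 := by
    rcases sgn_yang_baxter a1 b1 c1 with ⟨rfl, rfl⟩ | h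
    · ring
    · rw [h]; simp
  have e2 : (((sgn a2 b2 * sgn b2 c2 + sgn b2 c2 * sgn c2 a2 + sgn c2 a2 * sgn a2 b2 + 1 : ℤ) : ℂ)) *
      (x a1 c2 * x b1 a2 * x c1 b2 - x a1 b2 * x b1 c2 * x c1 a2) = 0 := by
    rcases sgn_yang_baxter a2 b2 c2 with ⟨rfl, rfl⟩ | h
    · ring
    · rw [h]; simp
  push_cast at e1 e2 ⊢
  linear_combination e1 - e2

theorem pd_bracket_matPoisson (d : Fin m × Fin n) {g h : Matrix (Fin m) (Fin n) ℂ → ℂ}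
    {x : Matrix (Fin m) (Fin n) ℂ} (hg : (matSpace m n).Reg g x) (hh : (matSpace m n).Reg h x) :
    pd d ((matSpace m n).bracket (matPoisson m n) g h) x =
      ∑ b, ∑ c, (pd d (fun y => coeff y b c) x * pd b g x * pd c h x
        + coeff x b c * pd d (pd b g) x * pd c h x + coeff x b c * pd b g x * pd d (pd c h) x) := by
  rw [pd_congr d (reg_bracket_matPoisson hg hh).1,
    pd_sum d fun b => reg_fun_sum _ fun c => reg_bracket_term hg hh b c]
  refine Finset.sum_congr rfl fun b _ => ?_
  rw [pd_sum d fun c => reg_bracket_term hg hh b c]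
  refine Finset.sum_congr rfl fun c _ => ?_
  refine (pd_mul d (f := fun y => coeff y b c * pd b g y) (g := pd c h)
    ((matSpace m n).reg_mul (reg_coeff b c x) (reg_pd b hg)) (reg_pd c hh)).trans ?_
  rw [pd_mul d (reg_coeff b c x) (reg_pd b hg)]
  ring

theorem isPoisson_matPoisson (m n : ℕ) : (matSpace m n).IsPoisson (matPoisson m n) where
  regular U _ f g hf hg x hx := (reg_bracket_matPoisson (hf x hx) (hg x hx)).2
  jacobi U _ f g h hf hg hh x hx := by
    rw [bracket_matPoisson (hf x hx) (reg_bracket_matPoisson (hg x hx) (hh x hx)).2,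
      bracket_matPoisson (hg x hx) (reg_bracket_matPoisson (hh x hx) (hf x hx)).2,
      bracket_matPoisson (hh x hx) (reg_bracket_matPoisson (hf x hx) (hg x hx)).2]
    simp only [pd_bracket_matPoisson _ (hg x hx) (hh x hx),
      pd_bracket_matPoisson _ (hh x hx) (hf x hx), pd_bracket_matPoisson _ (hf x hx) (hg x hx)]
    exact jacobi_of_coordinates (coeff_swap x) (fun a b c => jacobi_coeff a b c x) _ _ _
      (fun a b => pd_comm a b (hf x hx)) (fun a b => pd_comm a b (hg x hx))
      (fun a b => pd_comm a b (hh x hx))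

end MatPoisson

/-! ## Blocks of matrices of size `n + m` -/

section Blocks

variable {m n : ℕ}

theorem submatrix_mul_eq_add {k l : ℕ} (M N : Matrix (Fin (n + m)) (Fin (n + m)) ℂ)
    (f : Fin k → Fin (n + m)) (g : Fin l → Fin (n + m)) :
    (M * N).submatrix f g =
      M.submatrix f (Fin.castAdd m) * N.submatrix (Fin.castAdd m) g
        + M.submatrix f (Fin.natAdd n) * N.submatrix (Fin.natAdd n) g := by
  ext i j
  simp [Matrix.mul_apply, Fin.sum_univ_add]

theorem mem_parabolic_iff_submatrix {g : GL (Fin (n + m)) ℂ} :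
    g ∈ parabolic m n ↔ g.1.submatrix (Fin.natAdd n) (Fin.castAdd m) = 0 := by
  rw [mem_parabolic]
  constructor
  · intro h
    ext i j
    exact h _ _ (by simp) (by simp)
  · intro h i j
    refine Fin.addCases (fun i hi => ?_) (fun i _ => ?_) i
    · simp at hi
      omega
    · refine Fin.addCases (fun j _ => ?_) (fun j hj => ?_) j
      · exact congrFun (congrFun h i) j
      · simp at hj

theorem submatrix_natAdd_castAdd_one :
    (1 : Matrix (Fin (n + m)) (Fin (n + m)) ℂ).submatrix (Fin.natAdd n) (Fin.castAdd m) = 0 := by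
  ext i j
  exact Matrix.one_apply_ne (castAdd_ne_natAdd j i).symm

theorem submatrix_castAdd_castAdd_one :
    (1 : Matrix (Fin (n + m)) (Fin (n + m)) ℂ).submatrix (Fin.castAdd m) (Fin.castAdd m) = 1 :=
  Matrix.submatrix_one _ (Fin.castAdd_injective n m)

/-- The matrix `[[0, 0], [y, 0]]`. -/
def lowerBlock (y : Matrix (Fin m) (Fin n) ℂ) : Matrix (Fin (n + m)) (Fin (n + m)) ℂ :=
  Matrix.reindex finSumFinEquiv finSumFinEquiv (Matrix.fromBlocks 0 0 y 0)

theorem lowerUnipotent_eq (y : Matrix (Fin m) (Fin n) ℂ) :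
    (lowerUnipotent y).1 = 1 + lowerBlock y := by
  have h : Matrix.fromBlocks (1 : Matrix (Fin n) (Fin n) ℂ) 0 y (1 : Matrix (Fin m) (Fin m) ℂ) =
      1 + Matrix.fromBlocks 0 0 y 0 := by
    rw [← Matrix.fromBlocks_one, Matrix.fromBlocks_add]
    simp
  rw [lowerUnipotent, lowerBlock]
  simp only [h, Matrix.reindex_apply, Matrix.submatrix_add, Pi.add_apply,
    Matrix.submatrix_one_equiv]

theorem lowerUnipotent_inv (y : Matrix (Fin m) (Fin n) ℂ) :
    (lowerUnipotent y)⁻¹ = lowerUnipotent (-y) := by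
  refine inv_eq_of_mul_eq_one_right (Units.ext ?_)
  change (lowerUnipotent y).1 * (lowerUnipotent y).inv = 1
  exact (lowerUnipotent y).val_inv

theorem lowerBlock_castAdd {k : ℕ} (y : Matrix (Fin m) (Fin n) ℂ) (g : Fin k → Fin (n + m)) :
    (lowerBlock y).submatrix (Fin.castAdd m) g = 0 := by
  ext i j
  simp only [lowerBlock, Matrix.reindex_apply, Matrix.submatrix_apply,
    finSumFinEquiv_symm_apply_castAdd, Matrix.zero_apply]
  rcases finSumFinEquiv.symm (g j) with a | a <;> rfl

theorem lowerBlock_natAdd {k : ℕ} (y : Matrix (Fin m) (Fin n) ℂ) (f : Fin k → Fin (n + m)) :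
    (lowerBlock y).submatrix f (Fin.natAdd n) = 0 := by
  ext i j
  simp only [lowerBlock, Matrix.reindex_apply, Matrix.submatrix_apply,
    finSumFinEquiv_symm_apply_natAdd, Matrix.zero_apply]
  rcases finSumFinEquiv.symm (f i) with a | a <;> rfl

theorem lowerBlock_natAdd_castAdd (y : Matrix (Fin m) (Fin n) ℂ) :
    (lowerBlock y).submatrix (Fin.natAdd n) (Fin.castAdd m) = y := by
  ext i j
  simp [lowerBlock]

theorem lowerBlock_add (y z : Matrix (Fin m) (Fin n) ℂ) :
    lowerBlock (y + z) = lowerBlock y + lowerBlock z := by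
  have h : Matrix.fromBlocks 0 0 (y + z) (0 : Matrix (Fin m) (Fin m) ℂ) =
      Matrix.fromBlocks 0 0 y 0 + Matrix.fromBlocks (0 : Matrix (Fin n) (Fin n) ℂ) 0 z 0 := by
    rw [Matrix.fromBlocks_add]
    simp
  rw [lowerBlock, h]
  rfl

theorem lowerBlock_smul (c : ℂ) (y : Matrix (Fin m) (Fin n) ℂ) :
    lowerBlock (c • y) = c • lowerBlock y := by
  have h : Matrix.fromBlocks 0 0 (c • y) (0 : Matrix (Fin m) (Fin m) ℂ) =
      c • Matrix.fromBlocks (0 : Matrix (Fin n) (Fin n) ℂ) 0 y 0 := by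
    rw [Matrix.fromBlocks_smul]
    simp
  rw [lowerBlock, h]
  rfl

theorem lowerUnipotent_castAdd_castAdd (y : Matrix (Fin m) (Fin n) ℂ) :
    (lowerUnipotent y).1.submatrix (Fin.castAdd m) (Fin.castAdd m) = 1 := by
  rw [lowerUnipotent_eq]
  change (1 : Matrix (Fin (n + m)) (Fin (n + m)) ℂ).submatrix _ _ + (lowerBlock y).submatrix _ _ = _
  rw [submatrix_castAdd_castAdd_one, lowerBlock_castAdd, add_zero]

theorem lowerUnipotent_natAdd_castAdd (y : Matrix (Fin m) (Fin n) ℂ) :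
    (lowerUnipotent y).1.submatrix (Fin.natAdd n) (Fin.castAdd m) = y := by
  rw [lowerUnipotent_eq]
  change (1 : Matrix (Fin (n + m)) (Fin (n + m)) ℂ).submatrix _ _ + (lowerBlock y).submatrix _ _ = _
  rw [submatrix_natAdd_castAdd_one, lowerBlock_natAdd_castAdd, zero_add]

theorem lowerUnipotent_natAdd_natAdd (y : Matrix (Fin m) (Fin n) ℂ) :
    (lowerUnipotent y).1.submatrix (Fin.natAdd n) (Fin.natAdd n) = 1 := by
  rw [lowerUnipotent_eq]
  change (1 : Matrix (Fin (n + m)) (Fin (n + m)) ℂ).submatrix _ _ + (lowerBlock y).submatrix _ _ = _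
  rw [lowerBlock_natAdd, add_zero]
  exact Matrix.submatrix_one _ (Fin.natAdd_injective m n)

theorem lowerUnipotent_mem_lowerBorel (y : Matrix (Fin m) (Fin n) ℂ) :
    lowerUnipotent y ∈ lowerBorel (n + m) := by
  rw [mem_lowerBorel]
  intro i j hij
  rw [lowerUnipotent_eq, Matrix.add_apply, Matrix.one_apply_ne hij.ne, zero_add]
  induction i using Fin.addCases with
  | left i => exact congrFun (congrFun (lowerBlock_castAdd y (fun _ : Fin 1 => j)) i) 0
  | right i =>
    induction j using Fin.addCases with
    | left j => exact absurd hij (by rw [Fin.lt_def, Fin.val_natAdd, Fin.val_castAdd]; omega)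
    | right j => exact congrFun (congrFun (lowerBlock_natAdd y (fun _ : Fin 1 => _)) 0) j

/-- The upper left block. -/
def corner (g : GL (Fin (n + m)) ℂ) : Matrix (Fin n) (Fin n) ℂ :=
  g.1.submatrix (Fin.castAdd m) (Fin.castAdd m)

/-- The lower left block of `p` is zero, so the first `n` columns of `g` are just multiplied on the
right by the upper left block of `p`. This applies to both left blocks of `g` at once. -/
theorem submatrix_mul_parabolic {k : ℕ} (f : Fin k → Fin (n + m)) (g : GL (Fin (n + m)) ℂ)
    {p : GL (Fin (n + m)) ℂ} (hp : p ∈ parabolic m n) :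
    (g * p).1.submatrix f (Fin.castAdd m) = g.1.submatrix f (Fin.castAdd m) * corner p := by
  change (g.1 * p.1).submatrix _ _ = _
  rw [submatrix_mul_eq_add, mem_parabolic_iff_submatrix.1 hp, Matrix.mul_zero, add_zero, corner]

theorem corner_one : corner (1 : GL (Fin (n + m)) ℂ) = 1 := submatrix_castAdd_castAdd_one

theorem corner_mul_corner_inv {p : GL (Fin (n + m)) ℂ} (hp : p ∈ parabolic m n) :
    corner p * corner p⁻¹ = 1 := by
  have := submatrix_mul_parabolic (Fin.castAdd m) p (inv_mem hp)
  rw [mul_inv_cancel] at this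
  exact this.symm.trans corner_one

theorem isUnit_corner_of_parabolic {p : GL (Fin (n + m)) ℂ} (hp : p ∈ parabolic m n) :
    IsUnit (corner p) :=
  (Matrix.isUnit_iff_isUnit_det _).2 (Matrix.isUnit_det_of_right_inverse (corner_mul_corner_inv hp))

/-- Here the upper right block vanishes, which removes the cross term in the upper left block of
$bb^{-1}$. -/
theorem isUnit_corner_of_lowerBorel {b : GL (Fin (n + m)) ℂ} (hb : b ∈ lowerBorel (n + m)) :
    IsUnit (corner b) := by
  have h0 : b.1.submatrix (Fin.castAdd m) (Fin.natAdd n) = 0 := by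
    ext i j
    exact mem_lowerBorel.1 hb _ _ (by rw [Fin.lt_def, Fin.val_castAdd, Fin.val_natAdd]; omega)
  have h1 : corner b * corner b⁻¹ = 1 := by
    have := submatrix_mul_eq_add b.1 b⁻¹.1 (Fin.castAdd m) (Fin.castAdd m)
    rw [h0, Matrix.zero_mul, add_zero, ← Units.val_mul, mul_inv_cancel] at this
    exact this.symm.trans corner_one
  exact (Matrix.isUnit_iff_isUnit_det _).2 (Matrix.isUnit_det_of_right_inverse h1)

end Blocks

/-! ## The big cell -/

section Cell

variable {m n : ℕ}

/-- The coordinate `x` of `g P_n` on the big cell. -/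
def cellCoord (g : GL (Fin (n + m)) ℂ) : Matrix (Fin m) (Fin n) ℂ :=
  g.1.submatrix (Fin.natAdd n) (Fin.castAdd m) * (corner g)⁻¹ * longest n

/-- Both left blocks of `g` acquire the same invertible right factor, which cancels. Invertibility
of `corner g` is not needed, as the product rule for the matrix inverse holds also with its default
value `0`; hence `chart` is defined on the whole quotient. -/
theorem cellCoord_mul {g p : GL (Fin (n + m)) ℂ} (hp : p ∈ parabolic m n) :
    cellCoord (g * p) = cellCoord g := by
  have h1 : corner (g * p) = corner g * corner p := submatrix_mul_parabolic _ g hp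
  have h2 := (Matrix.isUnit_iff_isUnit_det _).1 (isUnit_corner_of_parabolic hp)
  rw [cellCoord, submatrix_mul_parabolic _ g hp, h1, Matrix.mul_inv_rev, Matrix.mul_assoc _ (corner p),
    ← Matrix.mul_assoc (corner p), Matrix.mul_nonsing_inv _ h2, Matrix.one_mul, cellCoord]

/-- The coordinate on the big cell as a function on the Grassmannian. -/
def chart (q : GL (Fin (n + m)) ℂ ⧸ parabolic m n) : Matrix (Fin m) (Fin n) ℂ :=
  Quotient.liftOn' q cellCoord fun a b h => by
    rw [← mul_inv_cancel_left a b]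
    exact (cellCoord_mul (QuotientGroup.leftRel_apply.1 h)).symm

theorem chart_mk (g : GL (Fin (n + m)) ℂ) :
    chart (g : GL (Fin (n + m)) ℂ ⧸ parabolic m n) = cellCoord g := rfl

theorem chart_psi (x : Matrix (Fin m) (Fin n) ℂ) : chart (psi m n x) = x := by
  rw [psi, chart_mk, cellCoord, corner, lowerUnipotent_castAdd_castAdd,
    lowerUnipotent_natAdd_castAdd, inv_one, Matrix.mul_one, Matrix.mul_assoc, longest_mul_self,
    Matrix.mul_one]

/-- With left blocks $A$, $C$ of $g$ and $y=CA^{-1}$, the lower left block of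
$\left[\begin{smallmatrix}1&0\\-y&1\end{smallmatrix}\right]g$ is $C-yA=0$. -/
theorem psi_cellCoord {g : GL (Fin (n + m)) ℂ} (hg : IsUnit (corner g)) :
    psi m n (cellCoord g) = (g : GL (Fin (n + m)) ℂ ⧸ parabolic m n) := by
  rw [psi, QuotientGroup.eq, mem_parabolic_iff_submatrix, lowerUnipotent_inv]
  change ((lowerUnipotent _).1 * g.1).submatrix _ _ = 0
  rw [submatrix_mul_eq_add, lowerUnipotent_natAdd_castAdd, lowerUnipotent_natAdd_natAdd,
    Matrix.one_mul, cellCoord, Matrix.mul_assoc _ (longest n), longest_mul_self, Matrix.mul_one,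
    Matrix.neg_mul, ← corner, Matrix.mul_assoc,
    Matrix.nonsing_inv_mul _ ((Matrix.isUnit_iff_isUnit_det _).1 hg), Matrix.mul_one,
    neg_add_cancel]

/-! ### The orbit as the locus of invertible upper left block. -/

theorem psi_mem_borelOrbit (x : Matrix (Fin m) (Fin n) ℂ) : psi m n x ∈ borelOrbit m n :=
  ⟨⟨_, lowerUnipotent_mem_lowerBorel _⟩, by
    change (((lowerUnipotent (x * longest n)) * 1 : GL (Fin (n + m)) ℂ) :
      GL (Fin (n + m)) ℂ ⧸ parabolic m n) = _
    rw [mul_one, psi]⟩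

/-- If $g=bp$, the upper left block of $g$ is the product of those of $b$ and $p$, both invertible.
Conversely, `psi_cellCoord` replaces $g$ by a lower unipotent representative, which lies in $B^-$.
-/
theorem mk_mem_borelOrbit {g : GL (Fin (n + m)) ℂ} :
    (g : GL (Fin (n + m)) ℂ ⧸ parabolic m n) ∈ borelOrbit m n ↔ IsUnit (corner g) := by
  constructor
  · rintro ⟨⟨b, hb⟩, h⟩
    have h2 : ((b * 1 : GL (Fin (n + m)) ℂ) : GL (Fin (n + m)) ℂ ⧸ parabolic m n) = g := h
    rw [mul_one, QuotientGroup.eq] at h2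
    have h3 : corner g = corner b * corner (b⁻¹ * g) := by
      have := submatrix_mul_parabolic (Fin.castAdd m) b h2
      rw [mul_inv_cancel_left] at this
      exact this
    rw [h3]
    exact (isUnit_corner_of_lowerBorel hb).mul (isUnit_corner_of_parabolic h2)
  · intro h
    rw [← psi_cellCoord h]
    exact psi_mem_borelOrbit _

theorem psi_chart {q : GL (Fin (n + m)) ℂ ⧸ parabolic m n} (hq : q ∈ borelOrbit m n) :
    psi m n (chart q) = q := by
  obtain ⟨g, rfl⟩ := QuotientGroup.mk_surjective q
  exact psi_cellCoord (mk_mem_borelOrbit.1 hq)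

/-- The parametrization of the big cell. -/
def cellEquiv (m n : ℕ) : (matSpace m n).carrier ≃ (orbitSpace m n).carrier where
  toFun x := ⟨psi m n x, psi_mem_borelOrbit x⟩
  invFun y := chart y.1
  left_inv x := chart_psi x
  right_inv y := Subtype.ext (psi_chart y.2)

/-! ### Regularity -/

theorem reg_fun_prod {X : FnSpace} {x : X.carrier} {κ : Type*} (s : Finset κ)
    {f : κ → X.carrier → ℂ} (hf : ∀ k, X.Reg (f k) x) : X.Reg (fun y => ∏ k ∈ s, f k y) x := by
  have := (X.regAlg x).prod_mem (t := s) fun k _ => (regAlg_coe.2 (hf k))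
  rw [regAlg_coe] at this
  convert this using 1
  funext y
  simp

theorem reg_mul_entry {X : FnSpace} {x : X.carrier} {k l p : ℕ}
    {A : X.carrier → Matrix (Fin k) (Fin l) ℂ} {B : X.carrier → Matrix (Fin l) (Fin p) ℂ}
    (hA : ∀ i j, X.Reg (fun y => A y i j) x) (hB : ∀ i j, X.Reg (fun y => B y i j) x)
    (i : Fin k) (j : Fin p) : X.Reg (fun y => (A y * B y) i j) x := by
  simp only [Matrix.mul_apply]
  exact reg_fun_sum _ fun s => X.reg_mul (hA i s) (hB s j)

theorem reg_det {X : FnSpace} {x : X.carrier} {k : ℕ}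
    {A : X.carrier → Matrix (Fin k) (Fin k) ℂ} (hA : ∀ i j, X.Reg (fun y => A y i j) x) :
    X.Reg (fun y => (A y).det) x := by
  simp only [Matrix.det_apply']
  exact reg_fun_sum _ fun σ => X.reg_mul (X.reg_const _ x) (reg_fun_prod _ fun i => hA _ _)

theorem reg_inv_entry {X : FnSpace} (hX : X.HasInverses) {x : X.carrier} {k : ℕ}
    {A : X.carrier → Matrix (Fin k) (Fin k) ℂ} (hA : ∀ i j, X.Reg (fun y => A y i j) x)
    (hx : IsUnit (A x)) (i j : Fin k) : X.Reg (fun y => (A y)⁻¹ i j) x := by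
  -- Cramer's rule: entries of the inverse are cofactors divided by the determinant.
  simp only [Matrix.inv_def, Ring.inverse_eq_inv', Matrix.smul_apply, smul_eq_mul,
    Matrix.adjugate_apply]
  refine X.reg_mul (hX _ x (reg_det hA) ?_).1 (reg_det fun a b => ?_)
  · exact ((Matrix.isUnit_iff_isUnit_det _).1 hx).ne_zero
  · simp only [Matrix.updateRow_apply]
    split_ifs
    · exact X.reg_const _ x
    · exact hA a b

theorem hasInverses_glSpace (k : ℕ) : (glSpace k).HasInverses :=
  (hasInverses_matSpace k k).induced _

theorem reg_glSpace_entry {k : ℕ} (g : GL (Fin k) ℂ) (i j : Fin k) :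
    (glSpace k).Reg (fun g : GL (Fin k) ℂ => g.1 i j) g :=
  (isMorphism_induced _).reg g _ (reg_entry i j g.1)

theorem open_borelOrbit (m n : ℕ) : (grassmannian m n).Open (borelOrbit m n) := by
  change (glSpace (n + m)).Open ((fun g : GL (Fin (n + m)) ℂ =>
    (g : GL (Fin (n + m)) ℂ ⧸ parabolic m n)) ⁻¹' borelOrbit m n)
  let _ := (glSpace (n + m)).top
  refine isOpen_iff_mem_nhds.2 fun g hg => ?_
  have h1 := mk_mem_borelOrbit.1 hg
  have h2 : (glSpace (n + m)).Reg (fun g : GL (Fin (n + m)) ℂ => (corner (m := m) g).det) g :=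
    reg_det fun i j => reg_glSpace_entry g _ _
  filter_upwards [(hasInverses_glSpace (n + m) _ g h2
    ((Matrix.isUnit_iff_isUnit_det _).1 h1).ne_zero).2] with g' hg'
  exact mk_mem_borelOrbit.2 ((Matrix.isUnit_iff_isUnit_det _).2 (isUnit_iff_ne_zero.2 hg'))

theorem reg_chart_entry {q : GL (Fin (n + m)) ℂ ⧸ parabolic m n} (hq : q ∈ borelOrbit m n)
    (i : Fin m) (j : Fin n) : (grassmannian m n).Reg
      (fun q : GL (Fin (n + m)) ℂ ⧸ parabolic m n => chart q i j) q := by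
  refine ⟨borelOrbit m n, open_borelOrbit m n, hq, fun g hg => ?_⟩
  refine reg_mul_entry (A := fun g : GL (Fin (n + m)) ℂ =>
      g.1.submatrix (Fin.natAdd n) (Fin.castAdd m) * (corner g)⁻¹) (B := fun _ => longest n)
    (reg_mul_entry (fun a b => reg_glSpace_entry g _ _) (reg_inv_entry (hasInverses_glSpace (n + m))
      (fun a b => reg_glSpace_entry g _ _) (mk_mem_borelOrbit.1 hg)))
    (fun a b => (glSpace (n + m)).reg_const _ g) i j

theorem isMorphism_cellEquiv_symm (m n : ℕ) :
    IsMorphism (orbitSpace m n) (matSpace m n) (cellEquiv m n).symm :=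
  isMorphism_to_matSpace
    ((((hasInverses_glSpace (n + m)).quotient _)).induced (fun y : borelOrbit m n => y.1))
    fun y i j => (isMorphism_induced (X := grassmannian m n)
      (fun y : borelOrbit m n => y.1)).reg y _ (reg_chart_entry y.2 i j)

theorem reg_lowerBlock_entry (x : Matrix (Fin m) (Fin n) ℂ) (i j : Fin (n + m)) :
    (matSpace m n).Reg (fun x => lowerBlock (x * longest n) i j) x := by
  simp only [lowerBlock, Matrix.reindex_apply, Matrix.submatrix_apply]
  rcases finSumFinEquiv.symm i with a | a <;> rcases finSumFinEquiv.symm j with b | b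
  · exact (matSpace m n).reg_const 0 x
  · exact (matSpace m n).reg_const 0 x
  · exact reg_mul_entry (X := matSpace m n) (A := fun x => x) (B := fun _ => longest n)
      (fun i j => reg_entry i j x) (fun i j => (matSpace m n).reg_const (longest n i j) x) a b
  · exact (matSpace m n).reg_const 0 x

theorem isMorphism_psi (m n : ℕ) : IsMorphism (matSpace m n) (grassmannian m n) (psi m n) := by
  have h : IsMorphism (matSpace m n) (glSpace (n + m))
      (fun x : Matrix (Fin m) (Fin n) ℂ => lowerUnipotent (x * longest n)) := by
    refine isMorphism_to_induced (isMorphism_to_matSpace (hasInverses_matSpace m n) ?_)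
    intro x i j
    simp only [Function.comp_apply, lowerUnipotent_eq]
    exact (matSpace m n).reg_add ((matSpace m n).reg_const _ x) (reg_lowerBlock_entry x i j)
  exact (isMorphism_quotient _).comp h

end Cell

/-! ## The Poisson structure on the big cell -/

section Comparison

variable {m n : ℕ}

/-- With $u$ the unipotent lift of `psi m n x`, the vector $au$ and the velocity of the lift of the
line $x+t\,$`cellVelocity x a` differ by an element of $u\cdot\mathrm{Lie}(P_n)$. This is what makes
`cellVelocity` correct. -/
theorem cellVelocity_identity (x : Matrix (Fin m) (Fin n) ℂ)
    (a : Matrix (Fin (n + m)) (Fin (n + m)) ℂ) :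
    ((lowerUnipotent (-(x * longest n))).1 * (a * (lowerUnipotent (x * longest n)).1
      - lowerBlock (cellVelocity x a * longest n))).submatrix (Fin.natAdd n) (Fin.castAdd m) = 0 := by
  have hsub : ∀ (M N : Matrix (Fin (n + m)) (Fin (n + m)) ℂ) {k l : ℕ} (f : Fin k → Fin (n + m))
      (g : Fin l → Fin (n + m)), (M - N).submatrix f g = M.submatrix f g - N.submatrix f g :=
    fun _ _ _ _ _ _ => rfl
  rw [submatrix_mul_eq_add, lowerUnipotent_natAdd_castAdd, lowerUnipotent_natAdd_natAdd,
    Matrix.one_mul, hsub, hsub, lowerBlock_castAdd, lowerBlock_natAdd_castAdd,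
    submatrix_mul_eq_add, submatrix_mul_eq_add, lowerUnipotent_castAdd_castAdd,
    lowerUnipotent_natAdd_castAdd, cellVelocity_apply]
  simp only [Matrix.mul_one, sub_zero, Matrix.add_mul, Matrix.sub_mul, Matrix.mul_add,
    Matrix.mul_assoc, longest_mul_self, Matrix.neg_mul]
  abel

/-- A function on a neighbourhood of `g` that is constant along cosets of `P_n` has no derivative
in the directions `g b` with `b` in the Lie algebra of `P_n`. -/
theorem deriv_eq_zero_of_parabolic {f : GL (Fin (n + m)) ℂ ⧸ parabolic m n → ℂ}
    {F : Matrix (Fin (n + m)) (Fin (n + m)) ℂ → ℂ} {g : GL (Fin (n + m)) ℂ}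
    (e : ∀ᶠ g' : GL (Fin (n + m)) ℂ in @nhds _ (glSpace (n + m)).top g,
      f (g' : GL (Fin (n + m)) ℂ ⧸ parabolic m n) = F g'.1)
    {b : Matrix (Fin (n + m)) (Fin (n + m)) ℂ}
    (hb : b.submatrix (Fin.natAdd n) (Fin.castAdd m) = 0) {d : ℂ}
    (hd : HasDerivAt (fun t : ℂ => F (g.1 + t • (g.1 * b))) d 0) : d = 0 := by
  have hn : @nhds _ (glSpace (n + m)).top g = Filter.comap
      (fun g : GL (Fin (n + m)) ℂ => (g.1 : Matrix (Fin (n + m)) (Fin (n + m)) ℂ))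
      (@nhds _ (zariski (n + m) (n + m)) g.1) :=
    @nhds_induced _ _ (zariski (n + m) (n + m)) _ g
  rw [Filter.Eventually, hn, Filter.mem_comap] at e
  obtain ⟨S, hS, hSe⟩ := e
  have h1 := zariski_tendsto (hasDerivAt_line g.1 (g.1 * b))
  rw [zero_smul, add_zero] at h1
  -- The element $1+tb$ replaces $\exp(tb)$: it is block triangular, and invertible for small $t$,
  -- so the line $g+tgb$ stays in the coset $gP_n$.
  have hdet : ∀ᶠ t : ℂ in 𝓝 0, (1 + t • b).det ≠ 0 := by
    have hc : Continuous fun t : ℂ => (1 + t • b).det := by fun_prop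
    exact hc.continuousAt.eventually_ne (by simp)
  have h2 : ∀ᶠ t : ℂ in 𝓝 0, F (g.1 + t • (g.1 * b)) =
      f (g : GL (Fin (n + m)) ℂ ⧸ parabolic m n) := by
    filter_upwards [h1 hS, hdet] with t ht ht2
    let u : GL (Fin (n + m)) ℂ := Matrix.GeneralLinearGroup.mkOfDetNeZero (1 + t • b) ht2
    have hu1 : (g * u).1 = g.1 + t • (g.1 * b) := by
      change g.1 * (1 + t • b) = _
      rw [Matrix.mul_add, Matrix.mul_one, Matrix.mul_smul]
    have hu : u ∈ parabolic m n := by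
      rw [mem_parabolic_iff_submatrix]
      change (1 : Matrix (Fin (n + m)) (Fin (n + m)) ℂ).submatrix _ _ + t • b.submatrix _ _ = 0
      rw [submatrix_natAdd_castAdd_one, hb, smul_zero, add_zero]
    have h3 : f ((g * u : GL (Fin (n + m)) ℂ) : GL (Fin (n + m)) ℂ ⧸ parabolic m n) =
        F (g * u).1 := hSe (show (g * u).1 ∈ S by rw [hu1]; exact ht)
    rw [← hu1, ← h3]
    refine congrArg f (QuotientGroup.eq.2 ?_)
    rw [mul_inv_rev, mul_assoc, inv_mul_cancel, mul_one]
    exact inv_mem hu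
  have h4 := hd.congr_of_eventuallyEq (f₁ := fun _ => f (g : GL (Fin (n + m)) ℂ ⧸ parabolic m n))
    (h2.mono fun t ht => ht.symm)
  exact h4.unique (hasDerivAt_const _ _)

/-- Two curves through the unipotent lift are compared: $\exp(ta)u$, and the lift of the line with
velocity `cellVelocity x a`. Their velocities differ upstairs, but only in a direction tangent to
the coset, which functions on the quotient do not see. -/
theorem grAction_chi_psi (x : Matrix (Fin m) (Fin n) ℂ) :
    (grAction m n).chi (psi m n x) =
      (isMorphism_psi m n).differential x ∘ₗ velocity x ∘ₗ cellVelocity x := by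
  refine LinearMap.ext fun a => tangent_ext fun f => ?_
  obtain ⟨U, -, hx, hU⟩ := f.2
  obtain ⟨F, hF, e⟩ := hU (lowerUnipotent (x * longest n)) hx
  obtain ⟨L, hL⟩ := matSpace_hasDerivAt hF
  have hn : @nhds _ (glSpace (n + m)).top (lowerUnipotent (x * longest n)) = Filter.comap
      (fun g : GL (Fin (n + m)) ℂ => (g.1 : Matrix (Fin (n + m)) (Fin (n + m)) ℂ))
      (@nhds _ (zariski (n + m) (n + m)) (lowerUnipotent (x * longest n)).1) :=
    @nhds_induced _ _ (zariski (n + m) (n + m)) _ _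
  have key : ∀ (c : ℂ → GL (Fin (n + m)) ℂ) (V : Matrix (Fin (n + m)) (Fin (n + m)) ℂ),
      c 0 = lowerUnipotent (x * longest n) →
      (∀ i j, HasDerivAt (fun t => (c t).1 i j) (V i j) 0) →
      HasDerivAt (fun t => f.1 (c t : GL (Fin (n + m)) ℂ ⧸ parabolic m n)) (L V) 0 := by
    intro c V h0 hV
    refine (hL (fun t => (c t).1) V (congrArg Units.val h0) hV).congr_of_eventuallyEq ?_
    have ht := zariski_tendsto hV
    rw [h0] at ht
    have ht2 : Filter.Tendsto c (𝓝 0)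
        (@nhds _ (glSpace (n + m)).top (lowerUnipotent (x * longest n))) := by
      rw [hn]
      exact Filter.tendsto_comap_iff.2 ht
    exact ht2.eventually e
  have h1 := key (fun t => expGL (t • a) * lowerUnipotent (x * longest n))
    (a * (lowerUnipotent (x * longest n)).1) (by rw [expGL_zero_smul, one_mul])
    (expGL_mul_hasDerivAt a _)
  have hline : ∀ t : ℂ, (lowerUnipotent ((x + t • cellVelocity x a) * longest n)).1 =
      (lowerUnipotent (x * longest n)).1 + t • lowerBlock (cellVelocity x a * longest n) := by
    intro t
    rw [lowerUnipotent_eq, lowerUnipotent_eq, Matrix.add_mul, Matrix.smul_mul, lowerBlock_add,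
      lowerBlock_smul, add_assoc]
  have h2 := key (fun t => lowerUnipotent ((x + t • cellVelocity x a) * longest n))
    (lowerBlock (cellVelocity x a * longest n)) (by simp) (fun i j => by
      simp only [hline]
      exact hasDerivAt_line _ _ i j)
  have h3 : L (a * (lowerUnipotent (x * longest n)).1
      - lowerBlock (cellVelocity x a * longest n)) = 0 := by
    refine deriv_eq_zero_of_parabolic e (cellVelocity_identity x a) ?_
    -- The difference of the velocities is written as $u\cdot u^{-1}(\ldots)$ to fit the form $gb$.
    rw [← Matrix.mul_assoc, ← lowerUnipotent_inv]
    have h4 : (lowerUnipotent (x * longest n)).1 * ((lowerUnipotent (x * longest n))⁻¹).1 = 1 :=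
      (lowerUnipotent (x * longest n)).mul_inv
    rw [h4, Matrix.one_mul]
    exact hL _ _ (by simp) (hasDerivAt_line _ _)
  rw [map_sub, sub_eq_zero] at h3
  exact h1.deriv.trans (h3.trans h2.deriv.symm)

theorem map_two_comp_comp {M₁ M₂ M₃ M₄ : Type*} [AddCommGroup M₁] [Module ℂ M₁] [AddCommGroup M₂]
    [Module ℂ M₂] [AddCommGroup M₃] [Module ℂ M₃] [AddCommGroup M₄] [Module ℂ M₄]
    (φ : M₃ →ₗ[ℂ] M₄) (ψ : M₂ →ₗ[ℂ] M₃) (θ : M₁ →ₗ[ℂ] M₂) (r : ⋀[ℂ]^2 M₁) :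
    exteriorPower.map 2 (φ ∘ₗ ψ ∘ₗ θ) r =
      exteriorPower.map 2 φ (exteriorPower.map 2 ψ (exteriorPower.map 2 θ r)) := by
  rw [exteriorPower.map_comp, exteriorPower.map_comp]
  rfl

theorem map_differential_psi (x : Matrix (Fin m) (Fin n) ℂ) :
    exteriorPower.map 2 ((isMorphism_psi m n).differential x) (matPoisson m n x) =
      grPoisson m n (psi m n x) := by
  have h1 : (grAction m n).chi₂ (rMatrix (n + m)) (psi m n x) =
      exteriorPower.map 2 ((isMorphism_psi m n).differential x) (exteriorPower.map 2 (velocity x)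
        (exteriorPower.map 2 (cellVelocity x) (rMatrix (n + m)))) :=
    (congrArg (fun φ => exteriorPower.map 2 φ (rMatrix (n + m))) (grAction_chi_psi x)).trans
      (map_two_comp_comp _ _ _ _)
  have h2 : matPoisson m n x = -exteriorPower.map 2 (velocity x)
      (exteriorPower.map 2 (cellVelocity x) (rMatrix (n + m))) := by
    refine (matPoisson_eq_map x).trans ?_
    rw [← map_cellVelocity_rMatrix]
    exact map_neg _ _
  exact (congrArg _ h2).trans ((map_neg _ _).trans (congrArg Neg.neg h1).symm)

theorem isPoissonMap_psi (m n : ℕ) : IsPoissonMap (matSpace m n) (grassmannian m n) (psi m n)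
    (matPoisson m n) (grPoisson m n) :=
  ⟨isMorphism_psi m n, map_differential_psi⟩

theorem open_range_borelOrbit (m n : ℕ) :
    (grassmannian m n).Open (Set.range fun y : borelOrbit m n => y.1) :=
  (Subtype.range_val (s := borelOrbit m n)).symm ▸ open_borelOrbit m n

/-- The restriction of `-χ(r^{n+m})` to the orbit `B⁻ . P_n`. -/
def orbitPoisson (m n : ℕ) : ∀ y, (orbitSpace m n).Bivector y :=
  restrict (X := grassmannian m n) Subtype.val_injective (open_range_borelOrbit m n)
    (grPoisson m n)

theorem isPoissonIso_cellEquiv (m n : ℕ) : IsPoissonIso (matSpace m n) (orbitSpace m n)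
    (cellEquiv m n) (matPoisson m n) (orbitPoisson m n) :=
  IsPoissonMap.isPoissonIso (φ := cellEquiv m n)
    (IsPoissonMap.to_restrict (X := grassmannian m n) (φ := cellEquiv m n) Subtype.val_injective
      (open_range_borelOrbit m n) (isPoissonMap_psi m n))
    (isMorphism_cellEquiv_symm m n)

end Comparison

end

theorem proposition3p4 (m n : ℕ) :
    (∀ x, matPoisson m n x = matPoissonCoord m n x) ∧
    (matSpace m n).IsPoisson (matPoisson m n) ∧
    (grassmannian m n).Open (borelOrbit m n) ∧
    ∃ Ψ : (matSpace m n).carrier ≃ (orbitSpace m n).carrier,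
      (∀ x, (Ψ x).1 = psi m n x) ∧
      ∃ πO : ∀ y, (orbitSpace m n).Bivector y,
        FnSpace.IsPoissonMap (orbitSpace m n) (grassmannian m n) (fun y => y.1)
          πO (grPoisson m n) ∧
        (∀ π' : ∀ y, (orbitSpace m n).Bivector y,
          FnSpace.IsPoissonMap (orbitSpace m n) (grassmannian m n) (fun y => y.1)
            π' (grPoisson m n) → π' = πO) ∧
        (orbitSpace m n).IsPoisson πO ∧
        FnSpace.IsPoissonIso (matSpace m n) (orbitSpace m n) Ψ (matPoisson m n) πO := by
  exact ⟨matPoisson_eq_coord, isPoisson_matPoisson m n, open_borelOrbit m n, cellEquiv m n,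
    fun x => rfl, orbitPoisson m n,
    FnSpace.isPoissonMap_restrict (X := grassmannian m n) Subtype.val_injective
      (open_range_borelOrbit m n) (grPoisson m n),
    fun π' h => FnSpace.eq_restrict (X := grassmannian m n) Subtype.val_injective
      (open_range_borelOrbit m n) h,
    (isPoissonIso_cellEquiv m n).isPoisson (isPoisson_matPoisson m n), isPoissonIso_cellEquiv m n⟩
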